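/- For real $\alpha>0$ let $\zeta(s,\alpha)$ be the Hurwitz zeta function ($\sum_{m\ge 0}(m+\alpha)^{-s}$ for $\Re s>1$, continued analytically to $s\ne 1$), and for an integer $x\ge 1$ let \[ \zeta_x(s,\alpha)=\sum_{n\ge x}(n+\alpha)^{-s}=\zeta(s,\alpha)-\sum_{0\le n<x}(n+\alpha)^{-s} \] (the series for $\Re s>1$, the last expression for all $s\neq 1$). Put $J_x(u,v)=\int_0^1\zeta_x(u,\alpha)\zeta_x(v,\alpha)\,d\alpha$, $(s)_n=\Gamma(s+n)/\Gamma(s)$, and let \[ E=\{(u,v)\in\mathbb C^2:\ u+v\in\{2,1,0,-1,-2,\dots\}\ \text{or}\ u\in\mathbb Z\ \text{or}\ v\in\mathbb Z\}. \] Let $x\ge 1$ be an integer and $(u,v)\in\mathbb C^2\setminus E$. Then the integral $J_x(u,v)$ and both series below converge (absolutely), and \begin{align*} J_x(u,v)={}&\frac{x^{1-u-v}}{u+v-1}+\left[\frac{\Gamma(1-u)}{\Gamma(v)}+\frac{\Gamma(1-v)}{\Gamma(u)}\right]\Gamma(u+v-1)\,\zeta(u+v-1)\\ &-\sum_{n=0}^{\infty}\frac{(u)_n\,x^{n+1-v}}{(1-v)_{n+1}}\,\zeta_x(u+n,1)-\sum_{n=0}^{\infty}\frac{(v)_n\,x^{n+1-u}}{(1-u)_{n+1}}\,\zeta_x(v+n,1),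 \end{align*} where $\zeta$ with one argument is the Riemann zeta function. Moreover, let \[ T_N(u,v;x)=\frac{(u)_N\,x^{N+1-v}}{(1-v)_N}\sum_{l=1}^{\infty}l^{1-u-v}\int_l^\infty\beta^{u+v-2}(x+\beta)^{-u-N}\,d\beta, \] where the integrals and the sum converge absolutely for every integer $N\ge 1$ with $-N+1<\Re u<N+1$ and $-N+1<\Re v<N+1$. Then, as $N\to\infty$ with $u,v,x$ fixed, \[ T_N(u,v;x)=O\!\left(N^{\Re(u+v)-1}\left(\frac{x}{x+1}\right)^{N}\right), \] and in particular $T_N(u,v;x)\to 0$. -/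

import Mathlib

open Filter Topology MeasureTheory

noncomputable section

namespace HurwitzMean

/-- The Hurwitz zeta function `ζ(s, α)` for every real `α > 0` (analytically continued in `s`).
Mathlib's `HurwitzZeta.hurwitzZeta` depends on `α` only modulo `1` and is the Hurwitz zeta function
of the representative in `(0, 1]`; the terms `(α - 1)^(-s), (α - 2)^(-s), …` with positive base are
removed for larger `α`. -/
def zeta (s : ℂ) (α : ℝ) : ℂ :=
  HurwitzZeta.hurwitzZeta (α : UnitAddCircle) s
    - ∑ j ∈ Finset.range (⌈α⌉₊ - 1), ((α - (j + 1) : ℝ) : ℂ) ^ (-s)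

/-- `ζ(s, α)` is the sum of the defining series for `Re s > 1`, `α > 0`. -/
theorem hasSum_zeta {s : ℂ} (hs : 1 < s.re) {α : ℝ} (hα : 0 < α) :
    HasSum (fun n : ℕ => ((n + α : ℝ) : ℂ) ^ (-s)) (zeta s α) := by
  set k : ℕ := ⌈α⌉₊ - 1 with hk
  have hc : ⌈α⌉₊ = k + 1 := by have := Nat.ceil_pos.2 hα; omega
  have h1 : α ≤ k + 1 := by have := Nat.le_ceil α; rw [hc] at this; exact_mod_cast this
  have h2 : (k : ℝ) < α := by
    have := Nat.ceil_lt_add_one hα.le; rw [hc] at this; push_cast at this; linarith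
  have h0 : ((α - k : ℝ) : UnitAddCircle) = (α : UnitAddCircle) := by
    rw [AddCircle.coe_sub, sub_eq_self]
    exact (AddCircle.coe_eq_zero_iff (1 : ℝ)).2 ⟨k, by simp⟩
  have h := HurwitzZeta.hasSum_hurwitzZeta_of_one_lt_re (a := α - k)
    ⟨by linarith, by linarith⟩ hs
  rw [h0] at h
  have h' := (hasSum_nat_add_iff' k).2 h
  have e1 : (fun n : ℕ => ((n + α : ℝ) : ℂ) ^ (-s))
      = fun n : ℕ => 1 / (((n + k : ℕ) : ℂ) + ((α - k : ℝ) : ℂ)) ^ s := by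
    funext n
    rw [one_div, ← Complex.cpow_neg]
    congr 1; push_cast; ring
  have e2 : ∑ j ∈ Finset.range k, ((α - (j + 1) : ℝ) : ℂ) ^ (-s)
      = ∑ i ∈ Finset.range k, 1 / ((i : ℂ) + ((α - k : ℝ) : ℂ)) ^ s := by
    rw [← Finset.sum_range_reflect]
    refine Finset.sum_congr rfl fun j hj => ?_
    have hj := Finset.mem_range.1 hj
    rw [one_div, ← Complex.cpow_neg]
    congr 1
    have : ((k - 1 - j : ℕ) : ℝ) = k - 1 - j := by
      rw [Nat.cast_sub (by omega), Nat.cast_sub (by omega)]; simp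
    rw [this]; push_cast; ring
  rw [e1, zeta, ← hk, e2]
  exact h'

/-- `ζ(s, α)` is holomorphic in `s ≠ 1`. -/
theorem differentiableAt_zeta {s : ℂ} (hs : s ≠ 1) (α : ℝ) :
    DifferentiableAt ℂ (fun s => zeta s α) s := by
  unfold zeta
  refine (HurwitzZeta.differentiableAt_hurwitzZeta _ hs).sub ?_
  refine DifferentiableAt.fun_sum fun j hj => ?_
  have hj := Finset.mem_range.1 hj
  have : ((j + 1 : ℕ) : ℝ) < α := Nat.lt_ceil.1 (by omega)
  push_cast at this
  refine DifferentiableAt.const_cpow (by fun_prop) (Or.inl ?_)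
  exact_mod_cast (by linarith : (0 : ℝ) < α - (j + 1)).ne'

/-- The modified Hurwitz zeta function `ζ_x(s, α) = ∑_{n ≥ x} (n + α)^(-s)`, continued in `s` as
`ζ(s, α) - ∑_{0 ≤ n < x} (n + α)^(-s)`. -/
def modZeta (x : ℕ) (s : ℂ) (α : ℝ) : ℂ :=
  zeta s α - ∑ n ∈ Finset.range x, ((n + α : ℝ) : ℂ) ^ (-s)

/-- The mean value `J_x(u, v) = ∫_0^1 ζ_x(u, α) ζ_x(v, α) dα`. -/
def J (x : ℕ) (u v : ℂ) : ℂ :=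
  ∫ α in (0 : ℝ)..1, modZeta x u α * modZeta x v α

/-- The exceptional set of pairs `(u, v)` with `u + v ∈ {2, 1, 0, -1, …}` or `u ∈ ℤ` or `v ∈ ℤ`. -/
def E : Set (ℂ × ℂ) :=
  {p | (∃ k : ℕ, p.1 + p.2 = 2 - k) ∨ (∃ k : ℤ, p.1 = k) ∨ (∃ k : ℤ, p.2 = k)}

/-- The Pochhammer symbol `(s)_n = Γ(s + n) / Γ(s)`. -/
def poch (s : ℂ) (n : ℤ) : ℂ :=
  Complex.Gamma (s + n) / Complex.Gamma s

/-- The series term `(u)_n x^(n+1-v) ζ_x(u+n, 1) / (1-v)_{n+1}`. -/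
def seriesTerm (u v : ℂ) (x n : ℕ) : ℂ :=
  poch u n * (x : ℂ) ^ ((n : ℂ) + 1 - v) / poch (1 - v) (n + 1) * modZeta x (u + n) 1

/-- The integrand `β^(u+v-2) (x+β)^(-u-N)`. -/
def remIntegrand (N : ℕ) (u v : ℂ) (x : ℕ) (β : ℝ) : ℂ :=
  (β : ℂ) ^ (u + v - 2) * ((x + β : ℝ) : ℂ) ^ (-u - N)

/-- The summand `l^(1-u-v) ∫_l^∞ β^(u+v-2) (x+β)^(-u-N) dβ`. -/
def remSummand (N : ℕ) (u v : ℂ) (x l : ℕ) : ℂ :=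
  (l : ℂ) ^ (1 - u - v) * ∫ β in Set.Ioi (l : ℝ), remIntegrand N u v x β

/-- The remainder
`T_N(u,v;x) = (u)_N x^(N+1-v) / (1-v)_N * ∑_{l ≥ 1} l^(1-u-v) ∫_l^∞ β^(u+v-2) (x+β)^(-u-N) dβ`. -/
def T (N : ℕ) (u v : ℂ) (x : ℕ) : ℂ :=
  poch u N * (x : ℂ) ^ ((N : ℂ) + 1 - v) / poch (1 - v) N * ∑' l : ℕ, remSummand N u v x (l + 1)

end HurwitzMean

end

/-!
# The mean value of the Hurwitz zeta function and its exact expansion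

For `Re u > 1` and `Re v > 1` the product of the two defining series can be integrated termwise over
`α ∈ (0, 1)`. The diagonal terms glue to `∫_x^∞ β^(-u-v) dβ`, and the terms whose summation indices
differ by `l ≥ 1` glue to `∫_x^∞ β^(-u) (β + l)^(-v) dβ` and the same integral with `u` and `v`
exchanged. If `Re u < 1`, the sum over `l` of such integrals is the sum over `(0, ∞)`, a beta
integral times `ζ(u + v - 1)`, minus the sum over `(0, x)`; there
`∑_l (β + l)^(-v) = ∑_n (v)_n / n! * (x - β)^n * ζ_x(v + n, 1)`, and integrating termwise against
`β^(-u)` gives exactly the series of the expansion. Integration by parts sends `(u, v)` to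
`(u - 1, v + 1)` and changes both sides of this evaluation in the same way, so it holds for all
non-integral `u` (`hasSum_integral_Ioi_cpow_mul`), which proves the expansion for `Re u, Re v > 1`.

The general case is analytic continuation along the complex line `t ↦ (u + t, v + t)`. It meets the
exceptional set in a countable closed set, whose complement in `ℂ` is connected, so only holomorphy
of both sides is needed (`differentiableAt_J`, `differentiableAt_expansion`). For `J_x` it comes
from the Taylor expansion `ζ_x(s, α) = ∑_n (s)_n / n! * (1 - α)^n * ζ_x(s + n, 1)`
(`modZeta_eq_tsum`): since `ζ_x(s + n, 1)` decays like `(x + 1)^(-n)` while ratios of rising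
factorials grow subexponentially, locally uniformly in the parameters, `J_x` is a locally uniformly
convergent double series of holomorphic functions, and the two series of the expansion
converge like a geometric series of any ratio larger than `x / (x + 1)`.

For the remainder, Euler's limit formula for `Γ` gives
`(u)_N / (1 - v)_N = O(N^(Re (u + v) - 1))`, and `x + β ≥ x + 1` on the domains of integration makes
the sum over `l` in `T_N` of size `O((x + 1)^(-N))`.
-/

namespace HurwitzMean

/-! ### Ratios of rising factorials and the binomial series -/

/-- The ratio `(a)_n / (b)_n` of rising factorials, as a finite product. It is polynomial in `a`,
and is the Taylor coefficient of `(1 - z) ^ (-a)` for `b = 1`. -/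
noncomputable def risingRatio (a b : ℂ) (n : ℕ) : ℂ :=
  ∏ k ∈ Finset.range n, (a + k) / (b + k)

theorem risingRatio_succ (a b : ℂ) (n : ℕ) :
    risingRatio a b (n + 1) = risingRatio a b n * ((a + n) / (b + n)) :=
  Finset.prod_range_succ _ _

theorem poch_natCast {s : ℂ} (hs : ∀ k : ℕ, s ≠ -k) (n : ℕ) :
    poch s n = ∏ k ∈ Finset.range n, (s + k) := by
  have h0 : Complex.Gamma s ≠ 0 := Complex.Gamma_ne_zero hs
  rw [poch, div_eq_iff h0]
  induction n with
  | zero => simp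
  | succ n ih =>
    rw [Finset.prod_range_succ, mul_right_comm, ← ih]
    have : s + (n : ℂ) ≠ 0 := fun h => hs n (eq_neg_of_add_eq_zero_left h)
    push_cast
    rw [← add_assoc, Complex.Gamma_add_one _ this]
    ring

theorem ne_neg_natCast {s : ℂ} (hs : ∀ k : ℤ, s ≠ k) (k : ℕ) : s ≠ -k := by
  simpa using hs (-k)

theorem one_sub_ne_neg_natCast {s : ℂ} (hs : ∀ k : ℤ, s ≠ k) (k : ℕ) : 1 - s ≠ -k := by
  intro h
  refine hs (k + 1) ?_
  push_cast
  linear_combination -h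

theorem prod_add_ne_zero {s : ℂ} (hs : ∀ k : ℕ, s ≠ -k) (n : ℕ) :
    ∏ k ∈ Finset.range n, (s + k) ≠ 0 :=
  Finset.prod_ne_zero_iff.2 fun k _ h => hs k (eq_neg_of_add_eq_zero_left h)

theorem prod_one_add (n : ℕ) : ∏ k ∈ Finset.range n, ((1 : ℂ) + k) = n.factorial := by
  rw [← Finset.prod_range_add_one_eq_factorial]
  push_cast
  exact Finset.prod_congr rfl fun k _ => add_comm _ _

theorem risingRatio_one (s : ℂ) (n : ℕ) :
    risingRatio s 1 n = (∏ k ∈ Finset.range n, (s + k)) / n.factorial := by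
  rw [risingRatio, Finset.prod_div_distrib, prod_one_add]

theorem hasSum_one_sub_cpow_neg (s : ℂ) {z : ℂ} (hz : ‖z‖ < 1) :
    HasSum (fun n => risingRatio s 1 n * z ^ n) ((1 - z) ^ (-s)) := by
  have h := (Complex.one_div_one_sub_cpow_hasFPowerSeriesOnBall_zero s).hasSum (y := z)
    (by simpa [enorm_eq_nnnorm, ← NNReal.coe_lt_coe] using hz)
  simp only [zero_add, FormalMultilinearSeries.ofScalars_apply_eq, one_div, ← Complex.cpow_neg] at h
  suffices e : ∀ n, risingRatio s 1 n = Ring.choose (s + n - 1) n by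
    simpa only [e, smul_eq_mul] using h
  intro n
  rw [risingRatio_one]
  have h1 := Ring.factorial_nsmul_multichoose_eq_ascPochhammer s n
  rw [Polynomial.ascPochhammer_smeval_eq_eval, Ring.multichoose_eq, nsmul_eq_mul] at h1
  rw [div_eq_iff (by exact_mod_cast n.factorial_ne_zero), mul_comm, h1]
  clear h1 h
  induction n with
  | zero => simp
  | succ n ih => rw [Finset.prod_range_succ, ih, ascPochhammer_succ_eval]

/-! ### Locally uniform geometric bounds -/

/-- A geometric bound that holds near `t₀` for all large indices holds for all indices, because the
finitely many remaining functions are bounded near `t₀` by continuity. -/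
theorem exists_eventually_norm_le {X : Type*} [TopologicalSpace X] {F : ℕ → X → ℂ} {t₀ : X}
    {r : ℝ} (hr : 0 < r) (hc : ∀ n, ContinuousAt (F n) t₀) {K : ℕ} {C : ℝ}
    (hK : ∀ᶠ t in 𝓝 t₀, ∀ n, K ≤ n → ‖F n t‖ ≤ C * r ^ n) :
    ∃ C', ∀ᶠ t in 𝓝 t₀, ∀ n, ‖F n t‖ ≤ C' * r ^ n := by
  set S : ℝ := ∑ n ∈ Finset.range K, (‖F n t₀‖ + 1) / r ^ n with hS
  have hpos : ∀ n, 0 ≤ (‖F n t₀‖ + 1) / r ^ n := fun n => by positivity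
  have hS0 : 0 ≤ S := Finset.sum_nonneg fun n _ => hpos n
  refine ⟨|C| + S, ?_⟩
  have h1 : ∀ᶠ t in 𝓝 t₀, ∀ n ∈ Finset.range K, ‖F n t‖ < ‖F n t₀‖ + 1 := by
    rw [Filter.eventually_all_finset]
    exact fun n _ => (hc n).norm.eventually_lt continuousAt_const (by linarith)
  filter_upwards [hK, h1] with t hK h1 n
  have hrn : 0 < r ^ n := by positivity
  rcases le_or_gt K n with h | h
  · refine (hK n h).trans (mul_le_mul_of_nonneg_right ?_ hrn.le)
    linarith [le_abs_self C]
  · have hn := Finset.mem_range.2 h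
    have h2 : (‖F n t₀‖ + 1) / r ^ n ≤ S :=
      Finset.single_le_sum (f := fun n => (‖F n t₀‖ + 1) / r ^ n) (fun n _ => hpos n) hn
    rw [div_le_iff₀ hrn] at h2
    have := h1 n hn
    nlinarith [abs_nonneg C]

theorem differentiableAt_tsum {ι : Type*} {F : ι → ℂ → ℂ} {t₀ : ℂ} {b : ι → ℝ} (hb : Summable b)
    (hF : ∀ᶠ t in 𝓝 t₀, ∀ i, DifferentiableAt ℂ (F i) t)
    (hFb : ∀ᶠ t in 𝓝 t₀, ∀ i, ‖F i t‖ ≤ b i) :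
    DifferentiableAt ℂ (fun t => ∑' i, F i t) t₀ := by
  obtain ⟨U, hU, hUo, ht⟩ := eventually_nhds_iff.1 (hF.and hFb)
  exact (Complex.differentiableOn_tsum_of_summable_norm hb
    (fun i t ht => ((hU t ht).1 i).differentiableWithinAt) hUo
    (fun i t ht => (hU t ht).2 i)).differentiableAt (hUo.mem_nhds ht)

theorem continuousAt_risingRatio {a₀ b₀ : ℂ} (hb : ∀ k : ℕ, b₀ ≠ -k) (n : ℕ) :
    ContinuousAt (fun p : ℂ × ℂ => risingRatio p.1 p.2 n) (a₀, b₀) := by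
  unfold risingRatio
  refine tendsto_finsetProd _ fun k _ => ?_
  refine ContinuousAt.div (by fun_prop) (by fun_prop) fun h => hb k ?_
  exact eq_neg_of_add_eq_zero_left h

theorem norm_add_div_add_le {a b : ℂ} {n : ℕ} {M ρ : ℝ} (ha : ‖a‖ ≤ M) (hb : ‖b‖ ≤ M)
    (hM : M < n) (h : M * (1 + ρ) ≤ n * (ρ - 1)) : ‖(a + n) / (b + n)‖ ≤ ρ := by
  have hden : (n : ℝ) - M ≤ ‖b + n‖ := by
    have := norm_sub_le (b + n) b
    simp only [add_sub_cancel_left, Complex.norm_natCast] at this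
    linarith
  have hnum : ‖a + n‖ ≤ M + n := by
    refine (norm_add_le _ _).trans ?_
    rw [Complex.norm_natCast]; linarith
  have hM0 : 0 ≤ M := (norm_nonneg a).trans ha
  have hρ : 1 ≤ ρ := by nlinarith
  rw [norm_div, div_le_iff₀ (by linarith)]
  calc ‖a + n‖ ≤ ρ * (n - M) := by linarith
    _ ≤ ρ * ‖b + n‖ := by gcongr

/-- Ratios of rising factorials grow slower than every geometric sequence of ratio larger than `1`,
locally uniformly in both parameters. -/
theorem exists_risingRatio_le {a₀ b₀ : ℂ} (hb : ∀ k : ℕ, b₀ ≠ -k) {ρ : ℝ} (hρ : 1 < ρ) :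
    ∃ C, ∀ᶠ p : ℂ × ℂ in 𝓝 (a₀, b₀), ∀ n, ‖risingRatio p.1 p.2 n‖ ≤ C * ρ ^ n := by
  have hρ0 : 0 < ρ := by linarith
  obtain ⟨M, hMa, hMb, hM0⟩ : ∃ M : ℝ, ‖a₀‖ < M ∧ ‖b₀‖ < M ∧ 0 < M :=
    ⟨‖a₀‖ + ‖b₀‖ + 1, by linarith [norm_nonneg b₀], by linarith [norm_nonneg a₀], by positivity⟩
  obtain ⟨K, hK1, hK2⟩ : ∃ K : ℕ, M * (1 + ρ) / (ρ - 1) < K ∧ M < K :=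
    ((tendsto_natCast_atTop_atTop.eventually_gt_atTop _).and
      (tendsto_natCast_atTop_atTop.eventually_gt_atTop _)).exists
  rw [div_lt_iff₀ (by linarith)] at hK1
  have hc := continuousAt_risingRatio (a₀ := a₀) hb
  suffices h : ∀ᶠ p : ℂ × ℂ in 𝓝 (a₀, b₀), ∀ n, K ≤ n →
      ‖risingRatio p.1 p.2 n‖ ≤ (‖risingRatio a₀ b₀ K‖ + 1) / ρ ^ K * ρ ^ n from
    exists_eventually_norm_le hρ0 hc h
  have e1 : ∀ᶠ p : ℂ × ℂ in 𝓝 (a₀, b₀), ‖p.1‖ < M :=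
    continuousAt_fst.norm.eventually_lt continuousAt_const hMa
  have e2 : ∀ᶠ p : ℂ × ℂ in 𝓝 (a₀, b₀), ‖p.2‖ < M :=
    continuousAt_snd.norm.eventually_lt continuousAt_const hMb
  have e3 : ∀ᶠ p : ℂ × ℂ in 𝓝 (a₀, b₀), ‖risingRatio p.1 p.2 K‖ < ‖risingRatio a₀ b₀ K‖ + 1 :=
    (hc K).norm.eventually_lt continuousAt_const (by simp)
  filter_upwards [e1, e2, e3] with p h1 h2 h3 n hn
  induction n, hn using Nat.le_induction with
  | base => rw [div_mul_cancel₀ _ (by positivity)]; exact h3.le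
  | succ n hn ih =>
    have hn' : (K : ℝ) ≤ n := by exact_mod_cast hn
    have hratio : ‖(p.1 + n) / (p.2 + n)‖ ≤ ρ := by
      refine norm_add_div_add_le h1.le h2.le (hK2.trans_le hn') ?_
      exact hK1.le.trans (mul_le_mul_of_nonneg_right hn' (by linarith))
    rw [risingRatio_succ, norm_mul, pow_succ, ← mul_assoc]
    exact mul_le_mul ih hratio (norm_nonneg _) ((norm_nonneg _).trans ih)

/-! ### The tails `ζ_x(s, α)` in the half-plane of convergence -/

theorem hasSum_modZeta (x : ℕ) {s : ℂ} (hs : 1 < s.re) {α : ℝ} (hα : 0 < α) :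
    HasSum (fun m : ℕ => ((m + x + α : ℝ) : ℂ) ^ (-s)) (modZeta x s α) := by
  have h := (hasSum_nat_add_iff' x).2 (hasSum_zeta hs hα)
  simpa [modZeta] using h

theorem differentiableAt_modZeta (x : ℕ) {s : ℂ} (hs : s ≠ 1) {α : ℝ} (hα : 0 < α) :
    DifferentiableAt ℂ (fun s => modZeta x s α) s := by
  unfold modZeta
  refine (differentiableAt_zeta hs α).sub (DifferentiableAt.fun_sum fun n _ => ?_)
  refine DifferentiableAt.const_cpow (by fun_prop) (Or.inl ?_)
  exact_mod_cast (by positivity : (0 : ℝ) < n + α).ne'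

theorem norm_ofReal_cpow_neg {y : ℝ} (hy : 0 < y) (s : ℂ) : ‖(y : ℂ) ^ (-s)‖ = y ^ (-s.re) := by
  rw [Complex.norm_cpow_eq_rpow_re_of_pos hy, Complex.neg_re]

theorem summable_add_rpow_neg {σ : ℝ} (hσ : 1 < σ) {c : ℝ} (hc : 0 < c) :
    Summable fun m : ℕ => (m + c : ℝ) ^ (-σ) := by
  have := (hasSum_zeta (s := σ) (by simpa using hσ) hc).summable.norm
  refine this.congr fun m => ?_
  rw [norm_ofReal_cpow_neg (by positivity), Complex.ofReal_re]

/-- `ζ_x(s + n, 1)` decays like `(x + 1) ^ (-n)`, locally uniformly in `s`. -/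
theorem exists_modZeta_le (x : ℕ) {s₀ : ℂ} (hs : ∀ n : ℕ, s₀ + n ≠ 1) :
    ∃ C, ∀ᶠ s in 𝓝 s₀, ∀ n : ℕ, ‖modZeta x (s + n) 1‖ ≤ C * ((x + 1 : ℝ)⁻¹) ^ n := by
  have hx : (0 : ℝ) < x + 1 := by positivity
  obtain ⟨K, hK⟩ := exists_nat_gt (2 - s₀.re)
  refine exists_eventually_norm_le (F := fun n s => modZeta x (s + n) 1) (inv_pos.2 hx)
    (fun n => ?_) (K := K) (C := (x + 1) ^ K * ∑' m : ℕ, (m + (x + 1) : ℝ) ^ (-(2 : ℝ))) ?_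
  · exact ((differentiableAt_modZeta x (hs n) one_pos).continuousAt).comp (f := fun s : ℂ => s + n)
      (by fun_prop)
  have e : ∀ᶠ s : ℂ in 𝓝 s₀, 2 - s.re < K :=
    ContinuousAt.eventually_lt (by fun_prop) continuousAt_const hK
  filter_upwards [e] with s hs n hn
  have hn' : (K : ℝ) ≤ n := by exact_mod_cast hn
  have hsum := summable_add_rpow_neg (σ := 2) (by norm_num) hx
  have h1 := hasSum_modZeta x (s := s + n) (by simp; linarith) one_pos
  rw [← h1.tsum_eq, mul_right_comm, ← tsum_mul_left]
  refine tsum_of_norm_bounded (hsum.mul_left _).hasSum fun m => ?_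
  have hy : (x + 1 : ℝ) ≤ m + (x + 1) := by simp
  rw [add_assoc, norm_ofReal_cpow_neg (by positivity)]
  have e1 : (x + 1 : ℝ) ^ K * ((x + 1 : ℝ)⁻¹) ^ n = (x + 1 : ℝ) ^ (-((n : ℝ) - K)) := by
    rw [Real.rpow_neg hx.le, Real.rpow_sub hx, Real.rpow_natCast, Real.rpow_natCast, inv_pow]
    field_simp
  rw [e1]
  have e2 : (m + (x + 1) : ℝ) ^ (-(s + n).re)
      = (m + (x + 1) : ℝ) ^ (-((n : ℝ) - K)) * (m + (x + 1) : ℝ) ^ (-(s.re + K)) := by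
    rw [← Real.rpow_add (by positivity)]
    congr 1
    simp
    ring
  rw [e2]
  refine mul_le_mul ?_ ?_ (by positivity) (by positivity)
  · exact Real.rpow_le_rpow_of_nonpos hx hy (by linarith)
  · exact Real.rpow_le_rpow_of_exponent_le (by linarith [(Nat.cast_nonneg x : (0:ℝ) ≤ x)])
      (by linarith)

/-! ### Taylor expansion of `ζ_x(s, α)` about `α = 1` -/

/-- The coefficient of `(1 - α) ^ n` in the Taylor expansion of `ζ_x(s, α)` about `α = 1`. -/
noncomputable def taylorCoeff (x : ℕ) (s : ℂ) (n : ℕ) : ℂ :=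
  risingRatio s 1 n * modZeta x (s + n) 1

theorem one_ne_neg_natCast (k : ℕ) : (1 : ℂ) ≠ -k := by
  intro h
  have := congrArg Complex.re h
  simp at this
  linarith [(Nat.cast_nonneg k : (0 : ℝ) ≤ k)]

/-- In the half-plane of convergence the Taylor series comes from the binomial series of every
term `(m + x + 1 - w) ^ (-s)`. -/
theorem hasSum_taylorCoeff_mul_pow (x : ℕ) {s : ℂ} (hs : 1 < s.re) {w : ℝ} (hw : 0 ≤ w)
    (hwx : w < x + 1) :
    HasSum (fun n => taylorCoeff x s n * (w : ℂ) ^ n)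
      (∑' m : ℕ, ((m + x + 1 - w : ℝ) : ℂ) ^ (-s)) := by
  have hx : (0 : ℝ) < x + 1 := by positivity
  let F : ℕ × ℕ → ℂ := fun p =>
    risingRatio s 1 p.1 * (w : ℂ) ^ p.1 * ((p.2 + x + 1 : ℝ) : ℂ) ^ (-(s + p.1))
  have hpow : ∀ m n : ℕ, ((m + x + 1 : ℝ) : ℂ) ^ (-(s + n))
      = ((m + x + 1 : ℝ) : ℂ) ^ (-s) * (((m + x + 1 : ℝ) : ℂ)⁻¹) ^ n := by
    intro m n
    have hy : ((m + x + 1 : ℝ) : ℂ) ≠ 0 := by exact_mod_cast (by positivity : (m + x + 1 : ℝ) ≠ 0)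
    rw [neg_add, Complex.cpow_add _ _ hy, Complex.cpow_neg _ (n : ℂ), Complex.cpow_natCast, inv_pow]
  have hF : Summable F := by
    -- Any `ρ` strictly between `1` and `(x + 1) / w` works; this one also makes sense for `w = 0`.
    obtain ⟨ρ, hρ, hq⟩ : ∃ ρ : ℝ, 1 < ρ ∧ ρ * w / (x + 1) < 1 := by
      refine ⟨2 * (x + 1) / (w + (x + 1)), ?_, ?_⟩
      · rw [one_lt_div (by linarith)]; linarith
      · rw [div_mul_eq_mul_div, div_div, div_lt_one (by positivity)]
        nlinarith
    obtain ⟨C, hC⟩ := exists_risingRatio_le (a₀ := s) one_ne_neg_natCast hρ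
    have hC := hC.self_of_nhds
    have hg : Summable fun n : ℕ => C * (ρ * w / (x + 1)) ^ n :=
      (summable_geometric_of_lt_one (by positivity) hq).mul_left C
    have hC0 : 0 ≤ C := by simpa using (norm_nonneg _).trans (hC 0)
    refine Summable.of_norm_bounded
      (hg.mul_of_nonneg (summable_add_rpow_neg hs hx) (fun n => by positivity)
        fun m => by positivity) ?_
    rintro ⟨n, m⟩
    simp only [F]
    rw [hpow, norm_mul, norm_mul, norm_mul, norm_ofReal_cpow_neg (by positivity), norm_pow,
      norm_pow, norm_inv, Complex.norm_of_nonneg hw, Complex.norm_of_nonneg (by positivity),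
      add_assoc (m : ℝ)]
    have h1 : ((m + (x + 1) : ℝ)⁻¹) ^ n ≤ ((x + 1 : ℝ)⁻¹) ^ n :=
      pow_le_pow_left₀ (by positivity) (inv_anti₀ hx (by simp)) n
    calc _ ≤ C * ρ ^ n * w ^ n * ((m + (x + 1) : ℝ) ^ (-s.re) * ((x + 1 : ℝ)⁻¹) ^ n) := by
          gcongr; exact hC n
      _ = _ := by rw [div_pow, mul_pow, inv_pow]; ring
  have h1 : HasSum (fun n => taylorCoeff x s n * (w : ℂ) ^ n) (∑' p, F p) := by
    refine hF.hasSum.prod_fiberwise fun n => ?_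
    have := (hasSum_modZeta x (s := s + n) (by simp; linarith [(Nat.cast_nonneg n : (0 : ℝ) ≤ n)])
      one_pos).mul_left (risingRatio s 1 n * (w : ℂ) ^ n)
    rw [taylorCoeff, mul_right_comm]
    exact this
  have h2 : HasSum (fun m : ℕ => ((m + x + 1 - w : ℝ) : ℂ) ^ (-s)) (∑' p, F p) := by
    refine HasSum.prod_fiberwise (f := fun p : ℕ × ℕ => F p.swap)
      ((Equiv.prodComm ℕ ℕ).hasSum_iff.2 hF.hasSum) fun m => ?_
    have hy : (0 : ℝ) < m + x + 1 := by positivity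
    have hwy : w < m + x + 1 := by linarith [(Nat.cast_nonneg m : (0 : ℝ) ≤ m)]
    have hz : ‖((w / (m + x + 1) : ℝ) : ℂ)‖ < 1 := by
      rw [Complex.norm_of_nonneg (by positivity), div_lt_one hy]; exact hwy
    have := (hasSum_one_sub_cpow_neg s hz).mul_left (((m + x + 1 : ℝ) : ℂ) ^ (-s))
    have e : ((m + x + 1 : ℝ) : ℂ) ^ (-s) * (1 - ((w / (m + x + 1) : ℝ) : ℂ)) ^ (-s)
        = ((m + x + 1 - w : ℝ) : ℂ) ^ (-s) := by
      rw [← Complex.ofReal_one, ← Complex.ofReal_sub, ← Complex.mul_cpow_ofReal_nonneg hy.le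
        (by rw [sub_nonneg, div_le_one hy]; exact hwy.le), ← Complex.ofReal_mul]
      congr 2
      field_simp
    rw [e] at this
    refine (funext fun n => ?_ : (fun n => F (m, n).swap) = _) ▸ this
    simp only [F, Prod.fst_swap, Prod.snd_swap]
    rw [hpow, Complex.ofReal_div, div_pow, inv_pow]
    ring
  rwa [h2.tsum_eq]

theorem add_natCast_ne_one {s : ℂ} (hs : ∀ k : ℤ, s ≠ k) (n : ℕ) : s + n ≠ 1 := by
  intro h
  refine hs (1 - n) ?_
  push_cast
  linear_combination h

theorem exists_taylorCoeff_le (x : ℕ) {s₀ : ℂ} (hs : ∀ n : ℕ, s₀ + n ≠ 1) {r : ℝ}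
    (hr : 1 < r * (x + 1)) :
    ∃ C, ∀ᶠ s in 𝓝 s₀, ∀ n, ‖taylorCoeff x s n‖ ≤ C * r ^ n := by
  obtain ⟨C₁, h₁⟩ := exists_risingRatio_le (a₀ := s₀) one_ne_neg_natCast hr
  obtain ⟨C₂, h₂⟩ := exists_modZeta_le x (s₀ := s₀) hs
  have hx : (0 : ℝ) < x + 1 := by positivity
  refine ⟨C₁ * C₂, ?_⟩
  have h₁' := (by fun_prop : ContinuousAt (fun s : ℂ => (s, (1 : ℂ))) s₀).eventually h₁
  filter_upwards [h₁', h₂] with s h1 h2 n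
  rw [taylorCoeff, norm_mul]
  refine (mul_le_mul (h1 n) (h2 n) (norm_nonneg _) ((norm_nonneg _).trans (h1 n))).trans_eq ?_
  rw [mul_pow, inv_pow]
  field_simp

theorem differentiableAt_taylorCoeff (x : ℕ) {s : ℂ} (hs : ∀ k : ℤ, s ≠ k) (n : ℕ) :
    DifferentiableAt ℂ (fun s => taylorCoeff x s n) s := by
  unfold taylorCoeff risingRatio
  refine DifferentiableAt.mul (DifferentiableAt.fun_finsetProd fun k _ => by fun_prop) ?_
  exact (differentiableAt_modZeta x (add_natCast_ne_one hs n) one_pos).comp s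
    (f := fun s : ℂ => s + n) (by fun_prop)

theorem countable_integers : {z : ℂ | ∃ k : ℤ, z = k}.Countable := by
  refine (Set.countable_range fun k : ℤ => (k : ℂ)).mono ?_
  rintro z ⟨k, rfl⟩
  exact ⟨k, rfl⟩

theorem isClosed_integers : IsClosed {z : ℂ | ∃ k : ℤ, z = k} := by
  convert Complex.isClosed_range_intCast using 1
  ext z
  simp [eq_comm]

/-- The Taylor expansion about `α = 1` persists under analytic continuation in `s`. -/
theorem modZeta_eq_tsum {x : ℕ} (hx : 1 ≤ x) {s : ℂ} (hs : ∀ k : ℤ, s ≠ k) {α : ℝ} (h0 : 0 < α)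
    (h1 : α ≤ 1) : modZeta x s α = ∑' n, taylorCoeff x s n * ((1 - α : ℝ) : ℂ) ^ n := by
  set U : Set ℂ := {z : ℂ | ∃ k : ℤ, z = k}ᶜ with hU
  have hUo : IsOpen U := isClosed_integers.isOpen_compl
  have hmem : ∀ {z}, z ∈ U ↔ ∀ k : ℤ, z ≠ k := by simp [hU]
  have hconn : IsPreconnected U :=
    (countable_integers.isConnected_compl_of_one_lt_rank (by simp)).isPreconnected
  have hx' : (1 : ℝ) ≤ x := by exact_mod_cast hx
  have hL : DifferentiableOn ℂ (fun s => modZeta x s α) U := fun s hs =>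
    (differentiableAt_modZeta x (by simpa using hmem.1 hs 1) h0).differentiableWithinAt
  have hR : DifferentiableOn ℂ (fun s => ∑' n, taylorCoeff x s n * ((1 - α : ℝ) : ℂ) ^ n) U := by
    intro s hs
    refine DifferentiableAt.differentiableWithinAt ?_
    obtain ⟨C, hC⟩ := exists_taylorCoeff_le x (add_natCast_ne_one (hmem.1 hs)) (r := 3 / 4)
      (by linarith)
    refine differentiableAt_tsum (b := fun n => C * (3 / 4 : ℝ) ^ n)
      ((summable_geometric_of_lt_one (by norm_num) (by norm_num)).mul_left C) ?_ ?_
    · filter_upwards [hUo.mem_nhds hs] with s hs n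
      exact (differentiableAt_taylorCoeff x (hmem.1 hs) n).mul_const _
    · filter_upwards [hC] with s hC n
      rw [norm_mul, norm_pow, Complex.norm_of_nonneg (by linarith)]
      exact (mul_le_of_le_one_right (norm_nonneg _)
        (pow_le_one₀ (by linarith) (by linarith))).trans (hC n)
  have hz : (3 / 2 : ℂ) ∈ U := by
    rw [hmem]
    intro k hk
    have h2 : (3 : ℂ) = ((2 * k : ℤ) : ℂ) := by push_cast; linear_combination 2 * hk
    have h3 : (3 : ℤ) = 2 * k := by exact_mod_cast h2
    omega
  refine (hL.analyticOnNhd hUo).eqOn_of_preconnected_of_eventuallyEq (hR.analyticOnNhd hUo) hconn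
    hz ?_ (hmem.2 hs)
  have : ∀ᶠ z : ℂ in 𝓝 (3 / 2), 1 < z.re :=
    continuousAt_const.eventually_lt (by fun_prop) (by norm_num)
  filter_upwards [this] with z hz
  rw [(hasSum_taylorCoeff_mul_pow x hz (w := 1 - α) (by linarith) (by linarith)).tsum_eq,
    ← (hasSum_modZeta x hz h0).tsum_eq]
  refine tsum_congr fun m => ?_
  congr 2
  ring

/-! ### The mean value as a double series -/

/-- Termwise integration, against an integrable weight `h`, of a series of continuous functions with
a summable uniform bound. -/
theorem hasSum_intervalIntegral_mul {ι : Type*} [Countable ι] {a b : ℝ} (hab : a ≤ b) {h : ℝ → ℂ}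
    (hh : IntervalIntegrable h volume a b) {F : ι → ℝ → ℂ}
    (hF : ∀ i, ContinuousOn (F i) (Set.Icc a b)) {B : ι → ℝ} (hB : Summable B)
    (hFB : ∀ i, ∀ t ∈ Set.Ioc a b, ‖F i t‖ ≤ B i) :
    HasSum (fun i => ∫ t in a..b, h t * F i t) (∫ t in a..b, h t * ∑' i, F i t) := by
  rw [← Set.uIcc_of_le hab] at hF
  rw [← Set.uIoc_of_le hab] at hFB
  refine intervalIntegral.hasSum_integral_of_dominated_convergence
    (fun i t => ‖h t‖ * B i) (fun i => ?_) (fun i => ?_) ?_ ?_ ?_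
  · exact (hh.mul_continuousOn (hF i)).aestronglyMeasurable_restrict_uIoc
  · refine ae_of_all _ fun t ht => ?_
    rw [norm_mul]
    exact mul_le_mul_of_nonneg_left (hFB i t ht) (norm_nonneg _)
  · exact ae_of_all _ fun t _ => hB.mul_left _
  · simp_rw [tsum_mul_left]
    exact hh.norm.mul_const _
  · refine ae_of_all _ fun t ht => ?_
    exact (Summable.of_norm_bounded hB fun i => hFB i t ht).hasSum.mul_left _

theorem norm_one_sub_pow_le {α : ℝ} (hα : α ∈ Set.Icc (0 : ℝ) 1) (n : ℕ) :
    ‖((1 - α : ℝ) : ℂ) ^ n‖ ≤ 1 := by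
  rw [norm_pow, Complex.norm_of_nonneg (by linarith [hα.2])]
  exact pow_le_one₀ (by linarith [hα.2]) (by linarith [hα.1])

theorem exists_taylorCoeff_le_three_quarters {x : ℕ} (hx : 1 ≤ x) {s₀ : ℂ} (hs : ∀ k : ℤ, s₀ ≠ k) :
    ∃ C, ∀ᶠ s in 𝓝 s₀, ∀ n, ‖taylorCoeff x s n‖ ≤ C * (3 / 4 : ℝ) ^ n := by
  have hx' : (1 : ℝ) ≤ x := by exact_mod_cast hx
  exact exists_taylorCoeff_le x (add_natCast_ne_one hs) (by linarith)

theorem summable_const_mul_pow (C : ℝ) : Summable fun n : ℕ => C * (3 / 4 : ℝ) ^ n :=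
  (summable_geometric_of_lt_one (by norm_num) (by norm_num)).mul_left C

theorem summable_norm_taylorCoeff {x : ℕ} (hx : 1 ≤ x) {s : ℂ} (hs : ∀ k : ℤ, s ≠ k) :
    Summable fun n => ‖taylorCoeff x s n‖ := by
  obtain ⟨C, hC⟩ := exists_taylorCoeff_le_three_quarters hx hs
  exact (summable_const_mul_pow C).of_nonneg_of_le (fun _ => norm_nonneg _) hC.self_of_nhds

theorem intervalIntegrable_modZeta_mul {x : ℕ} (hx : 1 ≤ x) {u v : ℂ} (hu : ∀ k : ℤ, u ≠ k)
    (hv : ∀ k : ℤ, v ≠ k) :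
    IntervalIntegrable (fun α : ℝ => modZeta x u α * modZeta x v α) volume 0 1 := by
  have hc : ∀ {s : ℂ}, (∀ k : ℤ, s ≠ k) →
      ContinuousOn (fun α : ℝ => ∑' n, taylorCoeff x s n * ((1 - α : ℝ) : ℂ) ^ n)
        (Set.Icc 0 1) := by
    intro s hs
    refine continuousOn_tsum (fun n => by fun_prop) (summable_norm_taylorCoeff hx hs)
      fun n α hα => ?_
    rw [norm_mul]
    exact mul_le_of_le_one_right (norm_nonneg _) (norm_one_sub_pow_le hα n)
  refine (((hc hu).mul (hc hv)).intervalIntegrable_of_Icc zero_le_one).congr ?_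
  rw [Set.uIoc_of_le zero_le_one]
  intro α hα
  simp only [Pi.mul_apply]
  rw [modZeta_eq_tsum hx hu hα.1 hα.2, modZeta_eq_tsum hx hv hα.1 hα.2]

theorem J_eq_tsum {x : ℕ} (hx : 1 ≤ x) {u v : ℂ} (hu : ∀ k : ℤ, u ≠ k) (hv : ∀ k : ℤ, v ≠ k) :
    J x u v = ∑' p : ℕ × ℕ, taylorCoeff x u p.1 * taylorCoeff x v p.2
      * ∫ α in (0 : ℝ)..1, ((1 - α : ℝ) : ℂ) ^ (p.1 + p.2) := by
  have hsu := summable_norm_taylorCoeff hx hu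
  have hsv := summable_norm_taylorCoeff hx hv
  have h := hasSum_intervalIntegral_mul (ι := ℕ × ℕ) zero_le_one (h := fun _ => 1)
    (intervalIntegrable_const) (F := fun p α => (taylorCoeff x u p.1 * ((1 - α : ℝ) : ℂ) ^ p.1) *
      (taylorCoeff x v p.2 * ((1 - α : ℝ) : ℂ) ^ p.2)) (fun p => by fun_prop)
    (hsu.mul_of_nonneg hsv (fun _ => norm_nonneg _) fun _ => norm_nonneg _) (fun p α hα => by
      have hα' := Set.Ioc_subset_Icc_self hα
      rw [norm_mul, norm_mul, norm_mul]
      exact mul_le_mul (mul_le_of_le_one_right (norm_nonneg _) (norm_one_sub_pow_le hα' _))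
        (mul_le_of_le_one_right (norm_nonneg _) (norm_one_sub_pow_le hα' _)) (by positivity)
        (norm_nonneg _))
  have e : J x u v = ∫ α in (0 : ℝ)..1, 1 * ∑' p : ℕ × ℕ,
      (taylorCoeff x u p.1 * ((1 - α : ℝ) : ℂ) ^ p.1) *
      (taylorCoeff x v p.2 * ((1 - α : ℝ) : ℂ) ^ p.2) := by
    rw [J]
    refine intervalIntegral.integral_congr_ae (ae_of_all _ fun α hα => ?_)
    rw [Set.uIoc_of_le zero_le_one] at hα
    have hα' := Set.Ioc_subset_Icc_self hα
    have hb : ∀ {s : ℂ}, (Summable fun n => ‖taylorCoeff x s n‖) →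
        Summable fun n => ‖taylorCoeff x s n * ((1 - α : ℝ) : ℂ) ^ n‖ := fun hs =>
      hs.of_nonneg_of_le (fun _ => norm_nonneg _) fun n => by
        rw [norm_mul]
        exact mul_le_of_le_one_right (norm_nonneg _) (norm_one_sub_pow_le hα' n)
    rw [modZeta_eq_tsum hx hu hα.1 hα.2, modZeta_eq_tsum hx hv hα.1 hα.2, one_mul,
      tsum_mul_tsum_of_summable_norm (hb hsu) (hb hsv)]
  rw [e, ← h.tsum_eq]
  refine tsum_congr fun p => ?_
  rw [← intervalIntegral.integral_const_mul]
  refine intervalIntegral.integral_congr fun α _ => ?_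
  ring

theorem eventually_add_ne_intCast {s t₀ : ℂ} (h : ∀ k : ℤ, s + t₀ ≠ k) :
    ∀ᶠ t in 𝓝 t₀, ∀ k : ℤ, s + t ≠ k := by
  have h1 : {z : ℂ | ∃ k : ℤ, z = k}ᶜ ∈ 𝓝 (s + t₀) :=
    isClosed_integers.isOpen_compl.mem_nhds (by simpa using h)
  filter_upwards [(by fun_prop : ContinuousAt (fun t => s + t) t₀).eventually h1] with t ht
  simpa using ht

theorem differentiableAt_J {x : ℕ} (hx : 1 ≤ x) {u v t₀ : ℂ} (hu : ∀ k : ℤ, u + t₀ ≠ k)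
    (hv : ∀ k : ℤ, v + t₀ ≠ k) : DifferentiableAt ℂ (fun t => J x (u + t) (v + t)) t₀ := by
  have hu' := eventually_add_ne_intCast hu
  have hv' := eventually_add_ne_intCast hv
  have e : (fun t => J x (u + t) (v + t)) =ᶠ[𝓝 t₀] fun t => ∑' p : ℕ × ℕ,
      taylorCoeff x (u + t) p.1 * taylorCoeff x (v + t) p.2
        * ∫ α in (0 : ℝ)..1, ((1 - α : ℝ) : ℂ) ^ (p.1 + p.2) := by
    filter_upwards [hu', hv'] with t hu hv using J_eq_tsum hx hu hv
  refine DifferentiableAt.congr_of_eventuallyEq ?_ e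
  obtain ⟨C₁, h₁⟩ := exists_taylorCoeff_le_three_quarters hx hu
  obtain ⟨C₂, h₂⟩ := exists_taylorCoeff_le_three_quarters hx hv
  have hC₁ : 0 ≤ C₁ := by simpa using (norm_nonneg _).trans (h₁.self_of_nhds 0)
  have hC₂ : 0 ≤ C₂ := by simpa using (norm_nonneg _).trans (h₂.self_of_nhds 0)
  refine differentiableAt_tsum ((summable_const_mul_pow C₁).mul_of_nonneg
    (summable_const_mul_pow C₂) (fun n => by positivity) fun n => by positivity) ?_ ?_
  · filter_upwards [hu', hv'] with t hu hv p
    refine DifferentiableAt.mul_const (DifferentiableAt.mul ?_ ?_) _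
    · exact (differentiableAt_taylorCoeff x hu p.1).comp t (f := fun t => u + t) (by fun_prop)
    · exact (differentiableAt_taylorCoeff x hv p.2).comp t (f := fun t => v + t) (by fun_prop)
  · filter_upwards [(by fun_prop : ContinuousAt (fun t => u + t) t₀).eventually h₁,
      (by fun_prop : ContinuousAt (fun t => v + t) t₀).eventually h₂] with t h1 h2 p
    rw [norm_mul, norm_mul]
    have h3 : ‖∫ α in (0 : ℝ)..1, ((1 - α : ℝ) : ℂ) ^ (p.1 + p.2)‖ ≤ 1 := by
      refine (intervalIntegral.norm_integral_le_of_norm_le_const fun α hα => ?_).trans_eq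
        (by simp : (1 : ℝ) * |1 - 0| = 1)
      rw [Set.uIoc_of_le zero_le_one] at hα
      exact norm_one_sub_pow_le (Set.Ioc_subset_Icc_self hα) _
    exact (mul_le_of_le_one_right (by positivity) h3).trans
      (mul_le_mul (h1 _) (h2 _) (norm_nonneg _) (by positivity))

/-! ### Integrals of `β ^ (-u) (β + l) ^ (-v)` over half-lines -/

theorem integrableOn_Ioi_cpow_mul_cpow {u v : ℂ} {c l : ℝ} (hc : 0 < c) (hl : 0 ≤ l) (hv : 0 ≤ v.re)
    (huv : 1 < (u + v).re) :
    IntegrableOn (fun β : ℝ => (β : ℂ) ^ (-u) * ((β + l : ℝ) : ℂ) ^ (-v)) (Set.Ioi c) := by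
  refine Integrable.mono' (integrableOn_Ioi_rpow_of_lt (a := -(u + v).re) (by linarith) hc) ?_ ?_
  · refine ContinuousOn.aestronglyMeasurable ?_ measurableSet_Ioi
    refine continuousOn_of_forall_continuousAt fun β hβ => ?_
    have hβ : 0 < β := hc.trans hβ
    refine ContinuousAt.mul ?_ ?_
    · exact ContinuousAt.cpow (by fun_prop) continuousAt_const (Complex.ofReal_mem_slitPlane.2 hβ)
    · exact ContinuousAt.cpow (by fun_prop) continuousAt_const
        (Complex.ofReal_mem_slitPlane.2 (by linarith))
  · refine (ae_restrict_iff' measurableSet_Ioi).2 (ae_of_all _ fun β hβ => ?_)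
    have hβ : 0 < β := hc.trans hβ
    rw [norm_mul, norm_ofReal_cpow_neg hβ, norm_ofReal_cpow_neg (by linarith), Complex.add_re,
      neg_add, Real.rpow_add hβ]
    exact mul_le_mul_of_nonneg_left
      (Real.rpow_le_rpow_of_nonpos hβ (by linarith) (by linarith)) (by positivity)

/-- The substitution `β = l y / (1 - y)` turns the integral over `(0, ∞)` into a beta integral. -/
theorem integral_Ioi_zero_cpow_mul_cpow {u v : ℂ} {l : ℝ} (hl : 0 < l) (hu : u.re < 1)
    (huv : 1 < (u + v).re) :
    IntegrableOn (fun β : ℝ => (β : ℂ) ^ (-u) * ((β + l : ℝ) : ℂ) ^ (-v)) (Set.Ioi 0) ∧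
    ∫ β in Set.Ioi (0 : ℝ), (β : ℂ) ^ (-u) * ((β + l : ℝ) : ℂ) ^ (-v)
      = (l : ℂ) ^ (1 - u - v) * Complex.betaIntegral (1 - u) (u + v - 1) := by
  set f : ℝ → ℝ := fun y => l * y / (1 - y) with hf
  set f' : ℝ → ℝ := fun y => l / (1 - y) ^ 2 with hf'
  have himg : f '' Set.Ioo 0 1 = Set.Ioi 0 := by
    ext β
    constructor
    · rintro ⟨y, hy, rfl⟩
      have : 0 < 1 - y := by linarith [hy.2]
      have := hy.1
      show 0 < l * y / (1 - y)
      positivity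
    · intro hβ
      have hβ : 0 < β := hβ
      refine ⟨β / (β + l), ⟨by positivity, (div_lt_one (by positivity)).2 (by linarith)⟩, ?_⟩
      simp only [hf]
      have : 1 - β / (β + l) = l / (β + l) := by field_simp; ring
      rw [this]
      field_simp
  have hder : ∀ y ∈ Set.Ioo (0 : ℝ) 1, HasDerivWithinAt f (f' y) (Set.Ioo 0 1) y := by
    intro y hy
    have hy1 : 1 - y ≠ 0 := by linarith [hy.2]
    have h := (((hasDerivAt_id y).const_mul l).div ((hasDerivAt_id y).const_sub 1) hy1)
    refine (h.congr_deriv ?_).hasDerivWithinAt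
    simp only [hf', id]
    congr 1
    ring
  have hinj : Set.InjOn f (Set.Ioo 0 1) := by
    intro a ha b hb hab
    have h1 : 1 - a ≠ 0 := by linarith [ha.2]
    have h2 : 1 - b ≠ 0 := by linarith [hb.2]
    simp only [hf] at hab
    rw [div_eq_div_iff h1 h2] at hab
    have : l * (a - b) = 0 := by linear_combination hab
    rcases mul_eq_zero.1 this with h | h
    · exact absurd h hl.ne'
    · linarith
  have hpt : ∀ y ∈ Set.Ioo (0 : ℝ) 1, |f' y| • ((f y : ℂ) ^ (-u) * ((f y + l : ℝ) : ℂ) ^ (-v))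
      = (l : ℂ) ^ (1 - u - v) * ((y : ℂ) ^ (1 - u - 1) * (1 - (y : ℂ)) ^ (u + v - 1 - 1)) := by
    intro y hy
    have hy0 : 0 < y := hy.1
    have hy1 : 0 < 1 - y := by linarith [hy.2]
    have hlc : (l : ℂ) ≠ 0 := by exact_mod_cast hl.ne'
    have hy1c : ((1 - y : ℝ) : ℂ) ≠ 0 := by exact_mod_cast hy1.ne'
    have e1 : f y = l * y * (1 - y)⁻¹ := rfl
    have e2 : f y + l = l * (1 - y)⁻¹ := by simp only [hf]; field_simp; ring
    have einv : ∀ s : ℂ, (((1 - y)⁻¹ : ℝ) : ℂ) ^ (-s) = ((1 - y : ℝ) : ℂ) ^ s := by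
      intro s
      rw [Complex.ofReal_inv, Complex.inv_cpow, Complex.cpow_neg, inv_inv]
      rw [Complex.arg_ofReal_of_nonneg hy1.le]
      exact Real.pi_pos.ne
    have e3 : |f' y| = l * ((1 - y) ^ 2)⁻¹ := by
      rw [abs_of_pos (by simp only [hf']; positivity)]; rfl
    rw [e2, e1, e3, Complex.ofReal_mul (l * y), Complex.mul_cpow_ofReal_nonneg (by positivity)
      (by positivity), Complex.ofReal_mul, Complex.mul_cpow_ofReal_nonneg hl.le hy0.le,
      Complex.ofReal_mul l, Complex.mul_cpow_ofReal_nonneg hl.le (by positivity), einv, einv,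
      Complex.real_smul, ← Complex.ofReal_one, ← Complex.ofReal_sub,
      show ((1 : ℝ) : ℂ) - u - v = 1 + -u + -v by push_cast; ring, Complex.cpow_add _ _ hlc,
      Complex.cpow_add _ _ hlc, Complex.cpow_one,
      show u + v - ((1 : ℝ) : ℂ) - ((1 : ℝ) : ℂ) = u + v - (2 : ℕ) by push_cast; ring,
      Complex.cpow_sub _ _ hy1c, Complex.cpow_add _ _ hy1c, Complex.cpow_natCast,
      show ((1 : ℝ) : ℂ) - u - ((1 : ℝ) : ℂ) = -u by ring]
    push_cast
    ring
  have hre1 : 0 < (1 - u).re := by simpa using hu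
  have hre2 : 0 < (u + v - 1).re := by simp at huv ⊢; linarith
  rw [← himg, integrableOn_image_iff_integrableOn_abs_deriv_smul measurableSet_Ioo hder hinj,
    integral_image_eq_integral_abs_deriv_smul measurableSet_Ioo hder hinj,
    setIntegral_congr_fun measurableSet_Ioo hpt, integrableOn_congr_fun hpt measurableSet_Ioo,
    integral_const_mul, Complex.betaIntegral, intervalIntegral.integral_of_le zero_le_one,
    integral_Ioc_eq_integral_Ioo]
  refine ⟨Integrable.const_mul ?_ _, rfl⟩
  have := Complex.betaIntegral_convergent hre1 hre2
  rw [intervalIntegrable_iff_integrableOn_Ioo_of_le zero_le_one] at this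
  exact this

/-! ### The integral over `(0, x)` as a series -/

theorem integral_cpow_mul_sub_pow {u : ℂ} (hu : u.re < 1) {a : ℝ} (ha : 0 < a) (n : ℕ) :
    ∫ β in (0 : ℝ)..a, (β : ℂ) ^ (-u) * ((a - β : ℝ) : ℂ) ^ n
      = (a : ℂ) ^ ((n : ℂ) + 1 - u) * (n.factorial / ∏ k ∈ Finset.range (n + 1), (1 - u + k)) := by
  have h := Complex.betaIntegral_scaled (1 - u) (n + 1) ha
  rw [Complex.betaIntegral_eval_nat_add_one_right (by simpa using hu)] at h
  rw [show (n : ℂ) + 1 - u = 1 - u + (n + 1) - 1 by ring, ← h]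
  refine intervalIntegral.integral_congr fun β _ => ?_
  rw [add_sub_cancel_right, Complex.cpow_natCast, show 1 - u - 1 = -u by ring]
  push_cast
  rfl

theorem ne_neg_natCast_of_re_pos {s : ℂ} (hs : 0 < s.re) (k : ℕ) : s ≠ -k := by
  rintro rfl
  simp at hs
  linarith [(Nat.cast_nonneg k : (0 : ℝ) ≤ k)]

theorem seriesTerm_eq {u v : ℂ} (hu : ∀ k : ℕ, u ≠ -k) (hv : ∀ k : ℕ, 1 - v ≠ -k) (x n : ℕ) :
    seriesTerm u v x n = (∏ k ∈ Finset.range n, (u + k)) * (x : ℂ) ^ ((n : ℂ) + 1 - v)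
      / (∏ k ∈ Finset.range (n + 1), (1 - v + k)) * modZeta x (u + n) 1 := by
  rw [seriesTerm, poch_natCast hu]
  have := poch_natCast hv (n + 1)
  push_cast at this
  rw [this]

/-- Expanding `∑_l (β + l) ^ (-v)` about `β = x` and integrating termwise. -/
theorem hasSum_integral_zero_cpow_mul {x : ℕ} (hx : 1 ≤ x) {u v : ℂ} (hu : u.re < 1)
    (hv : 1 < v.re) :
    HasSum (fun l : ℕ => ∫ β in (0 : ℝ)..x, (β : ℂ) ^ (-u) * ((β + (l + 1) : ℝ) : ℂ) ^ (-v))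
      (∑' n, seriesTerm v u x n) := by
  have hx' : (0 : ℝ) < x := by exact_mod_cast hx
  have hint : IntervalIntegrable (fun β : ℝ => (β : ℂ) ^ (-u)) volume 0 x :=
    intervalIntegral.intervalIntegrable_cpow' (by simpa using hu)
  have h1 := hasSum_intervalIntegral_mul (ι := ℕ) hx'.le hint
    (F := fun l β => ((β + (l + 1) : ℝ) : ℂ) ^ (-v)) (fun l => ?_)
    (summable_add_rpow_neg hv one_pos) (fun l β hβ => ?_)
  rotate_left
  · refine continuousOn_of_forall_continuousAt fun β hβ => ?_
    have := hβ.1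
    exact ContinuousAt.cpow (by fun_prop) continuousAt_const
      (Complex.ofReal_mem_slitPlane.2 (by positivity))
  · have := hβ.1
    rw [norm_ofReal_cpow_neg (by positivity)]
    exact Real.rpow_le_rpow_of_nonpos (by positivity) (by linarith) (by linarith)
  have htay : ∀ β ∈ Set.Icc (0 : ℝ) x,
      HasSum (fun n => taylorCoeff x v n * ((x - β : ℝ) : ℂ) ^ n)
        (∑' l : ℕ, ((β + (l + 1) : ℝ) : ℂ) ^ (-v)) := by
    intro β hβ
    have h := hasSum_taylorCoeff_mul_pow x hv (w := x - β) (by linarith [hβ.2])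
      (by linarith [hβ.1])
    convert h using 4 with l
    congr 1
    ring
  obtain ⟨ρ, hρ1, hρ2⟩ := exists_between (show (1 : ℝ) / (x + 1) < 1 / x from
    one_div_lt_one_div_of_lt hx' (by linarith))
  have hρ0 : 0 < ρ := lt_trans (by positivity) hρ1
  obtain ⟨C, hC⟩ : ∃ C, ∀ n, ‖taylorCoeff x v n‖ ≤ C * ρ ^ n := by
    rw [div_lt_iff₀ (by positivity)] at hρ1
    obtain ⟨C, hC⟩ := exists_taylorCoeff_le x (s₀ := v) (fun n h => by
      have := congrArg Complex.re h
      simp at this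
      linarith [(Nat.cast_nonneg n : (0 : ℝ) ≤ n)]) hρ1
    exact ⟨C, hC.self_of_nhds⟩
  have h2 := hasSum_intervalIntegral_mul (ι := ℕ) hx'.le hint
    (F := fun n β => taylorCoeff x v n * ((x - β : ℝ) : ℂ) ^ n) (fun n => by fun_prop)
    (B := fun n => C * (ρ * x) ^ n) ((summable_geometric_of_lt_one (by positivity)
      (by rwa [lt_div_iff₀ hx'] at hρ2)).mul_left C) (fun n β hβ => ?_)
  swap
  · rw [norm_mul, norm_pow, Complex.norm_of_nonneg (by linarith [hβ.2]), mul_pow, ← mul_assoc]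
    have h0 : 0 ≤ x - β := by linarith [hβ.2]
    refine mul_le_mul (hC n) (pow_le_pow_left₀ h0 (by linarith [hβ.1]) n) (by positivity)
      ((norm_nonneg _).trans (hC n))
  have e : ∑' n, seriesTerm v u x n = ∫ β in (0 : ℝ)..x, (β : ℂ) ^ (-u) *
      ∑' l : ℕ, ((β + (l + 1) : ℝ) : ℂ) ^ (-v) := by
    have e1 : ∫ β in (0 : ℝ)..x, (β : ℂ) ^ (-u) * ∑' l : ℕ, ((β + (l + 1) : ℝ) : ℂ) ^ (-v)
        = ∫ β in (0 : ℝ)..x, (β : ℂ) ^ (-u) *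
          ∑' n : ℕ, taylorCoeff x v n * ((x - β : ℝ) : ℂ) ^ n := by
      refine intervalIntegral.integral_congr fun β hβ => ?_
      rw [Set.uIcc_of_le hx'.le] at hβ
      rw [(htay β hβ).tsum_eq]
    rw [e1, ← h2.tsum_eq]
    refine tsum_congr fun n => ?_
    have e2 : ∫ β in (0 : ℝ)..x, (β : ℂ) ^ (-u) * (taylorCoeff x v n * ((x - β : ℝ) : ℂ) ^ n)
        = taylorCoeff x v n * ∫ β in (0 : ℝ)..x, (β : ℂ) ^ (-u) * ((x - β : ℝ) : ℂ) ^ n := by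
      rw [← intervalIntegral.integral_const_mul]
      refine intervalIntegral.integral_congr fun β _ => ?_
      ring
    rw [e2, integral_cpow_mul_sub_pow hu hx', seriesTerm_eq
      (ne_neg_natCast_of_re_pos (by linarith)) (ne_neg_natCast_of_re_pos (by simpa using hu)),
      taylorCoeff, risingRatio_one]
    have : (n.factorial : ℂ) ≠ 0 := by exact_mod_cast n.factorial_ne_zero
    push_cast
    field_simp
  rw [e]
  exact h1

/-! ### Convergence and holomorphy of the series -/

theorem add_ne_intCast {s : ℂ} (hs : ∀ k : ℤ, s ≠ k) (m k : ℤ) : s + m ≠ k := by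
  intro h
  refine hs (k - m) ?_
  push_cast
  linear_combination h

theorem seriesTerm_eq_risingRatio {u v : ℂ} (hu : ∀ k : ℤ, u ≠ k) (hv : ∀ k : ℤ, v ≠ k) {x : ℕ}
    (hx : 1 ≤ x) (n : ℕ) :
    seriesTerm u v x n = (x : ℂ) ^ (1 - v) / (1 - v) * risingRatio u (2 - v) n * (x : ℂ) ^ n
      * modZeta x (u + n) 1 := by
  have hx0 : (x : ℂ) ≠ 0 := by exact_mod_cast (by omega : x ≠ 0)
  rw [seriesTerm_eq (ne_neg_natCast hu) (one_sub_ne_neg_natCast hv), Finset.prod_range_succ',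
    risingRatio, Finset.prod_div_distrib, add_sub_assoc, Complex.cpow_add _ _ hx0,
    Complex.cpow_natCast]
  have e : ∏ k ∈ Finset.range n, (1 - v + ((k + 1 : ℕ) : ℂ))
      = ∏ k ∈ Finset.range n, (2 - v + (k : ℂ)) :=
    Finset.prod_congr rfl fun k _ => by push_cast; ring
  rw [e]
  simp only [Nat.cast_zero, add_zero, div_eq_mul_inv, mul_inv]
  ring

/-- The terms of the series decay geometrically, locally uniformly in `(u, v)`. -/
theorem exists_seriesTerm_le {x : ℕ} (hx : 1 ≤ x) {u₀ v₀ : ℂ} (hu : ∀ k : ℤ, u₀ ≠ k)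
    (hv : ∀ k : ℤ, v₀ ≠ k) : ∃ b : ℕ → ℝ, Summable b ∧
      ∀ᶠ p : ℂ × ℂ in 𝓝 (u₀, v₀), ∀ n, ‖seriesTerm p.1 p.2 x n‖ ≤ b n := by
  have hx' : (0 : ℝ) < x := by exact_mod_cast hx
  obtain ⟨ρ, hρ1, hρ2⟩ := exists_between (show (1 : ℝ) < (x + 1) / x by
    rw [one_lt_div hx']; linarith)
  have hv2 : ∀ k : ℕ, 2 - v₀ ≠ -k := by
    intro k h
    refine hv (2 + k) ?_
    push_cast
    linear_combination -h
  obtain ⟨C₁, h₁⟩ := exists_risingRatio_le (a₀ := u₀) hv2 hρ1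
  obtain ⟨C₂, h₂⟩ := exists_modZeta_le x (add_natCast_ne_one hu)
  set A : ℂ × ℂ → ℂ := fun p => (x : ℂ) ^ (1 - p.2) / (1 - p.2) with hA
  have hAc : ContinuousAt A (u₀, v₀) := by
    refine ContinuousAt.div ?_ (by fun_prop) ?_
    · exact ContinuousAt.const_cpow (by fun_prop) (Or.inl (by exact_mod_cast hx'.ne'))
    · simpa using one_sub_ne_neg_natCast hv 0
  have e0 := hAc.norm.eventually_lt (continuousAt_const (y := ‖A (u₀, v₀)‖ + 1)) (by simp)
  have e1 := (by fun_prop : ContinuousAt (fun p : ℂ × ℂ => (p.1, 2 - p.2)) (u₀, v₀)).eventually h₁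
  have e2 := (continuousAt_fst (p := (u₀, v₀))).eventually h₂
  have e3 : ∀ᶠ p : ℂ × ℂ in 𝓝 (u₀, v₀), ∀ k : ℤ, p.1 ≠ k := by
    have := eventually_add_ne_intCast (s := 0) (t₀ := u₀) (by simpa using hu)
    simpa using (continuousAt_fst (p := (u₀, v₀))).eventually this
  have e4 : ∀ᶠ p : ℂ × ℂ in 𝓝 (u₀, v₀), ∀ k : ℤ, p.2 ≠ k := by
    have := eventually_add_ne_intCast (s := 0) (t₀ := v₀) (by simpa using hv)
    simpa using (continuousAt_snd (p := (u₀, v₀))).eventually this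
  have hr : ρ * x / (x + 1) < 1 := by
    rw [lt_div_iff₀ hx'] at hρ2
    rwa [div_lt_one (by positivity)]
  refine ⟨fun n => (‖A (u₀, v₀)‖ + 1) * C₁ * C₂ * (ρ * x / (x + 1)) ^ n,
    (summable_geometric_of_lt_one (by positivity) hr).mul_left _, ?_⟩
  filter_upwards [e0, e1, e2, e3, e4] with p h0 h1 h2 h3 h4 n
  rw [seriesTerm_eq_risingRatio h3 h4 hx, norm_mul, norm_mul, norm_mul, norm_pow,
    Complex.norm_natCast]
  calc _ ≤ (‖A (u₀, v₀)‖ + 1) * (C₁ * ρ ^ n) * (x : ℝ) ^ n * (C₂ * ((x + 1 : ℝ)⁻¹) ^ n) := by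
        have := (norm_nonneg _).trans (h1 n)
        have := (norm_nonneg _).trans (h2 n)
        have := h0.le
        gcongr
        · exact h1 n
        · exact h2 n
    _ = _ := by rw [div_pow, mul_pow, inv_pow]; ring

theorem summable_seriesTerm {x : ℕ} (hx : 1 ≤ x) {u v : ℂ} (hu : ∀ k : ℤ, u ≠ k)
    (hv : ∀ k : ℤ, v ≠ k) : Summable (seriesTerm u v x) := by
  obtain ⟨b, hb, h⟩ := exists_seriesTerm_le hx hu hv
  exact Summable.of_norm_bounded hb h.self_of_nhds

theorem differentiableAt_tsum_seriesTerm {x : ℕ} (hx : 1 ≤ x) {u v t₀ : ℂ}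
    (hu : ∀ k : ℤ, u + t₀ ≠ k) (hv : ∀ k : ℤ, v + t₀ ≠ k) :
    DifferentiableAt ℂ (fun t => ∑' n, seriesTerm (u + t) (v + t) x n) t₀ := by
  obtain ⟨b, hb, h⟩ := exists_seriesTerm_le hx hu hv
  have hu' := eventually_add_ne_intCast hu
  have hv' := eventually_add_ne_intCast hv
  refine differentiableAt_tsum hb ?_ ((by fun_prop :
    ContinuousAt (fun t => (u + t, v + t)) t₀).eventually h)
  filter_upwards [hu'.eventually_nhds, hv'.eventually_nhds] with t hut hvt n
  have e : (fun t => seriesTerm (u + t) (v + t) x n) =ᶠ[𝓝 t] fun t =>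
      (x : ℂ) ^ (1 - (v + t)) / (1 - (v + t)) * risingRatio (u + t) (2 - (v + t)) n * (x : ℂ) ^ n
      * modZeta x (u + t + n) 1 := by
    filter_upwards [hut, hvt] with t hu hv using seriesTerm_eq_risingRatio hu hv hx n
  refine DifferentiableAt.congr_of_eventuallyEq ?_ e
  have hut := hut.self_of_nhds
  have hvt := hvt.self_of_nhds
  have hx0 : (x : ℂ) ≠ 0 := by exact_mod_cast (by omega : x ≠ 0)
  refine DifferentiableAt.mul (DifferentiableAt.mul (DifferentiableAt.mul ?_ ?_)
    (differentiableAt_const _)) ?_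
  · refine DifferentiableAt.div ?_ (by fun_prop) (by simpa using one_sub_ne_neg_natCast hvt 0)
    exact DifferentiableAt.const_cpow (by fun_prop) (Or.inl hx0)
  · unfold risingRatio
    refine DifferentiableAt.fun_finsetProd fun k _ => ?_
    refine DifferentiableAt.div (by fun_prop) (by fun_prop) fun h => hvt (2 + k) ?_
    push_cast
    linear_combination -h
  · exact (differentiableAt_modZeta x (add_natCast_ne_one hut n) one_pos).comp t
      (f := fun t => u + t + n) (by fun_prop)

/-- The recursion for the series that matches integration by parts of the off-diagonal integrals. -/
theorem tsum_seriesTerm_eq {x : ℕ} (hx : 1 ≤ x) {u v : ℂ} (hu : ∀ k : ℤ, u ≠ k)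
    (hv : ∀ k : ℤ, v ≠ k) :
    ∑' n, seriesTerm u v x n = (x : ℂ) ^ (1 - v) / (1 - v) * modZeta x u 1
      + u / (1 - v) * ∑' n, seriesTerm (u + 1) (v - 1) x n := by
  have hu1 : ∀ k : ℤ, u + 1 ≠ k := by simpa using add_ne_intCast hu 1
  have hv1 : ∀ k : ℤ, v - 1 ≠ k := by simpa [sub_eq_add_neg] using add_ne_intCast hv (-1)
  have hv0 : 1 - v ≠ 0 := by simpa using one_sub_ne_neg_natCast hv 0
  rw [(summable_seriesTerm hx hu hv).tsum_eq_zero_add, ← tsum_mul_left]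
  congr 1
  · rw [seriesTerm_eq (ne_neg_natCast hu) (one_sub_ne_neg_natCast hv)]
    simp
  · refine tsum_congr fun n => ?_
    rw [seriesTerm_eq (ne_neg_natCast hu) (one_sub_ne_neg_natCast hv),
      seriesTerm_eq (ne_neg_natCast hu1) (one_sub_ne_neg_natCast hv1), Finset.prod_range_succ',
      Finset.prod_range_succ' _ (n + 1)]
    have e1 : ∏ k ∈ Finset.range n, (u + ((k + 1 : ℕ) : ℂ))
        = ∏ k ∈ Finset.range n, (u + 1 + (k : ℂ)) :=
      Finset.prod_congr rfl fun k _ => by push_cast; ring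
    have e2 : ∏ k ∈ Finset.range (n + 1), (1 - v + ((k + 1 : ℕ) : ℂ))
        = ∏ k ∈ Finset.range (n + 1), (1 - (v - 1) + (k : ℂ)) :=
      Finset.prod_congr rfl fun k _ => by push_cast; ring
    have h2 := prod_add_ne_zero (one_sub_ne_neg_natCast hv1) (n + 1)
    rw [e1, e2, show ((n + 1 : ℕ) : ℂ) + 1 - v = n + 1 - (v - 1) by push_cast; ring,
      show u + ((n + 1 : ℕ) : ℂ) = u + 1 + n by push_cast; ring]
    simp only [Nat.cast_zero, add_zero]
    field_simp

/-! ### The off-diagonal sum -/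

theorem hasDerivAt_ofReal_add_cpow {l β : ℝ} (h : 0 < β + l) (s : ℂ) :
    HasDerivAt (fun β : ℝ => ((β + l : ℝ) : ℂ) ^ s) (s * ((β + l : ℝ) : ℂ) ^ (s - 1)) β := by
  have h1 : HasDerivAt (fun z : ℂ => (z + l) ^ s) (s * ((β : ℂ) + l) ^ (s - 1) * 1) (β : ℂ) := by
    refine ((hasDerivAt_id (β : ℂ)).add_const (l : ℂ)).cpow_const ?_
    rw [id, ← Complex.ofReal_add]
    exact Complex.ofReal_mem_slitPlane.2 h
  have h2 := h1.comp_ofReal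
  simpa using h2

theorem integral_Ioi_cpow_mul_cpow_by_parts {u v : ℂ} (hu : 1 - u ≠ 0) {c l : ℝ} (hc : 0 < c)
    (hl : 0 ≤ l) (hv : 0 ≤ v.re) (huv : 1 < (u + v).re) :
    ∫ β in Set.Ioi c, (β : ℂ) ^ (-u) * ((β + l : ℝ) : ℂ) ^ (-v)
      = -((c : ℂ) ^ (1 - u) / (1 - u) * ((c + l : ℝ) : ℂ) ^ (-v))
        + v / (1 - u) *
          ∫ β in Set.Ioi c, (β : ℂ) ^ (-(u - 1)) * ((β + l : ℝ) : ℂ) ^ (-(v + 1)) := by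
  have hI1 := integrableOn_Ioi_cpow_mul_cpow hc hl hv huv
  have hI2 := integrableOn_Ioi_cpow_mul_cpow (u := u - 1) (v := v + 1) hc hl (by simp; linarith)
    (by simpa using huv)
  have hU : ∀ β ∈ Set.Ioi c, HasDerivAt (fun β : ℝ => ((β + l : ℝ) : ℂ) ^ (-v))
      (-v * ((β + l : ℝ) : ℂ) ^ (-v - 1)) β := fun β hβ =>
    hasDerivAt_ofReal_add_cpow (by linarith [hc.trans hβ]) _
  have hV : ∀ β ∈ Set.Ici c, HasDerivAt (fun β : ℝ => (β : ℂ) ^ (1 - u) / (1 - u))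
      ((β : ℂ) ^ (-u)) β := fun β hβ => by
    have hβ : 0 < β := hc.trans_le hβ
    have h := (hasDerivAt_ofReal_add_cpow (l := 0) (by simpa using hβ) (1 - u)).div_const (1 - u)
    simp only [add_zero] at h
    refine h.congr_deriv ?_
    rw [show 1 - u - 1 = -u by ring]
    field_simp
  have hprod := integral_Ioi_mul_deriv_eq_deriv_mul (a := c)
    (a' := ((c + l : ℝ) : ℂ) ^ (-v) * ((c : ℂ) ^ (1 - u) / (1 - u))) (b' := 0)
    hU (fun β hβ => hV β (Set.Ioi_subset_Ici_self hβ)) ?_ ?_ ?_ ?_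
  · rw [show (∫ β in Set.Ioi c, (β : ℂ) ^ (-u) * ((β + l : ℝ) : ℂ) ^ (-v))
      = ∫ β in Set.Ioi c, ((β + l : ℝ) : ℂ) ^ (-v) * (β : ℂ) ^ (-u) by simp_rw [mul_comm],
      hprod, ← integral_const_mul]
    have : ∀ β : ℝ, -v * ((β + l : ℝ) : ℂ) ^ (-v - 1) * ((β : ℂ) ^ (1 - u) / (1 - u))
        = -(v / (1 - u) * ((β : ℂ) ^ (-(u - 1)) * ((β + l : ℝ) : ℂ) ^ (-(v + 1)))) := by
      intro β
      rw [show -(v + 1) = -v - 1 by ring, neg_sub]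
      ring
    simp_rw [this]
    rw [integral_neg]
    ring
  · refine hI1.congr_fun (fun β _ => ?_) measurableSet_Ioi
    simp only [Pi.mul_apply]
    ring
  · refine IntegrableOn.congr_fun (s := Set.Ioi c) (hI2.const_mul (-v / (1 - u)))
      (fun β _ => ?_) measurableSet_Ioi
    simp only [Pi.mul_apply]
    rw [show -(v + 1) = -v - 1 by ring, neg_sub]
    ring
  · refine ContinuousAt.continuousWithinAt (f := (fun β : ℝ => ((β + l : ℝ) : ℂ) ^ (-v)) *
      fun β : ℝ => (β : ℂ) ^ (1 - u) / (1 - u)) ?_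
    exact (hasDerivAt_ofReal_add_cpow (by linarith) _).continuousAt.mul
      (hV c Set.self_mem_Ici).continuousAt
  · rw [tendsto_zero_iff_norm_tendsto_zero]
    have hlim : Tendsto (fun β : ℝ => β ^ (-((u + v).re - 1)) * ‖1 - u‖⁻¹) atTop (𝓝 0) := by
      simpa using (tendsto_rpow_neg_atTop (by linarith : 0 < (u + v).re - 1)).mul_const ‖1 - u‖⁻¹
    refine squeeze_zero' (Eventually.of_forall fun _ => norm_nonneg _) ?_ hlim
    filter_upwards [eventually_gt_atTop 0] with β hβ
    rw [Pi.mul_apply, norm_mul, norm_div, norm_ofReal_cpow_neg (by linarith),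
      Complex.norm_cpow_eq_rpow_re_of_pos hβ, ← mul_div_assoc, div_eq_mul_inv]
    refine mul_le_mul_of_nonneg_right ?_ (by positivity)
    rw [show -((u + v).re - 1) = -v.re + (1 - u).re by simp; ring, Real.rpow_add hβ]
    exact mul_le_mul_of_nonneg_right
      (Real.rpow_le_rpow_of_nonpos hβ (by linarith) (by linarith)) (by positivity)

theorem hasSum_riemannZeta {s : ℂ} (hs : 1 < s.re) :
    HasSum (fun l : ℕ => ((l + 1 : ℝ) : ℂ) ^ (-s)) (riemannZeta s) := by
  have h : Summable fun l : ℕ => ((l + 1 : ℝ) : ℂ) ^ (-s) := by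
    refine Summable.of_norm ((summable_add_rpow_neg hs one_pos).congr fun l => ?_)
    rw [norm_ofReal_cpow_neg (by positivity)]
  have e : riemannZeta s = ∑' l : ℕ, ((l + 1 : ℝ) : ℂ) ^ (-s) := by
    rw [zeta_eq_tsum_one_div_nat_add_one_cpow hs]
    refine tsum_congr fun l => ?_
    rw [Complex.cpow_neg, one_div]
    push_cast
    rfl
  rw [e]
  exact h.hasSum

/-- The off-diagonal part of the mean value. For `Re u < 1` it is the integral over `(0, ∞)` minus
the one over `(0, x)`; integration by parts lowers `Re u` by one and carries the formula to all
non-integral `u`. -/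
theorem hasSum_integral_Ioi_cpow_mul {x : ℕ} (hx : 1 ≤ x) {u v : ℂ} (hu : ∀ k : ℤ, u ≠ k)
    (hv : ∀ k : ℤ, v ≠ k) (hv1 : 1 < v.re) (huv : 2 < (u + v).re) :
    HasSum (fun l : ℕ => ∫ β in Set.Ioi (x : ℝ), (β : ℂ) ^ (-u) * ((β + (l + 1) : ℝ) : ℂ) ^ (-v))
      (Complex.Gamma (1 - u) / Complex.Gamma v * Complex.Gamma (u + v - 1) * riemannZeta (u + v - 1)
        - ∑' n, seriesTerm v u x n) := by
  have hx0 : (0 : ℝ) < x := by exact_mod_cast hx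
  obtain ⟨k, hk⟩ := exists_nat_gt (u.re - 1)
  induction k generalizing u v with
  | zero =>
    have hu1 : u.re < 1 := by simp at hk; linarith
    have hG : Complex.betaIntegral (1 - u) (u + v - 1)
        = Complex.Gamma (1 - u) / Complex.Gamma v * Complex.Gamma (u + v - 1) := by
      have hΓ : Complex.Gamma v ≠ 0 := Complex.Gamma_ne_zero (ne_neg_natCast hv)
      have := Complex.Gamma_mul_Gamma_eq_betaIntegral (s := 1 - u) (t := u + v - 1)
        (by simpa using hu1) (by simp at huv ⊢; linarith)
      rw [show 1 - u + (u + v - 1) = v by ring] at this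
      rw [div_mul_eq_mul_div, this, mul_div_cancel_left₀ _ hΓ]
    have h1 := (hasSum_riemannZeta (s := u + v - 1) (by simp at huv ⊢; linarith)).mul_left
      (Complex.betaIntegral (1 - u) (u + v - 1))
    rw [hG] at h1
    refine (funext fun l => ?_ : (fun l : ℕ => ∫ β in Set.Ioi (x : ℝ),
      (β : ℂ) ^ (-u) * ((β + (l + 1) : ℝ) : ℂ) ^ (-v)) = _) ▸
      h1.sub (hasSum_integral_zero_cpow_mul hx hu1 hv1)
    obtain ⟨hi, he⟩ := integral_Ioi_zero_cpow_mul_cpow (u := u) (v := v) (l := l + 1)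
      (by positivity) hu1 (by linarith)
    have hsplit := intervalIntegral.integral_interval_add_Ioi hi
      (hi.mono_set (Set.Ioi_subset_Ioi hx0.le))
    rw [eq_sub_iff_add_eq', hsplit, he, hG, neg_sub, show 1 - (u + v) = 1 - u - v by ring, mul_comm]
  | succ k ih =>
    have hu1 : ∀ k : ℤ, u - 1 ≠ k := by simpa [sub_eq_add_neg] using add_ne_intCast hu (-1)
    have hv2 : ∀ k : ℤ, v + 1 ≠ k := by simpa using add_ne_intCast hv 1
    have hu0 : 1 - u ≠ 0 := by simpa using one_sub_ne_neg_natCast hu 0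
    have hv0 : v ≠ 0 := by simpa using hv 0
    have ih := ih hu1 hv2 (by simp; linarith) (by simpa using huv)
      (by push_cast at hk; simp; linarith)
    have hZ := (hasSum_modZeta x hv1 one_pos).mul_left ((x : ℂ) ^ (1 - u) / (1 - u))
    have h := hZ.neg.add (ih.mul_left (v / (1 - u)))
    have e1 : Complex.Gamma (1 - (u - 1)) = (1 - u) * Complex.Gamma (1 - u) := by
      rw [← Complex.Gamma_add_one _ hu0]; congr 1; ring
    rw [tsum_seriesTerm_eq hx hv hu]
    rw [e1, Complex.Gamma_add_one _ hv0, show u - 1 + (v + 1) - 1 = u + v - 1 by ring] at h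
    have e2 : ∀ a b c d e : ℂ, -a + v / (1 - u) * ((1 - u) * b / (v * c) * d - e)
        = b / c * d - (a + v / (1 - u) * e) := by
      intro a b c d e
      rcases eq_or_ne c 0 with rfl | hc
      · simp; ring
      · field_simp; ring
    rw [mul_assoc _ (Complex.Gamma _) (riemannZeta _), e2, ← mul_assoc] at h
    refine (funext fun l => ?_ : (fun l : ℕ => ∫ β in Set.Ioi (x : ℝ),
      (β : ℂ) ^ (-u) * ((β + (l + 1) : ℝ) : ℂ) ^ (-v)) = _) ▸ h
    rw [integral_Ioi_cpow_mul_cpow_by_parts hu0 hx0 (by positivity) (by linarith) (by linarith)]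
    rw [Complex.ofReal_natCast, show (l + x + 1 : ℝ) = x + (l + 1) by ring]

/-! ### The mean value in the region of absolute convergence -/

/-- A double series splits into its diagonal and its two off-diagonal parts. -/
theorem hasSum_prod_eq_diag_add {a : ℕ × ℕ → ℂ} {S D G H : ℂ} {g h : ℕ → ℂ} (ha : HasSum a S)
    (hD : HasSum (fun i => a (i, i)) D) (hg : ∀ l, HasSum (fun i => a (i, i + (l + 1))) (g l))
    (hG : HasSum g G) (hh : ∀ l, HasSum (fun i => a (i + (l + 1), i)) (h l)) (hH : HasSum h H) :
    S = D + G + H := by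
  let e₁ : ℕ → ℕ × ℕ := fun i => (i, i)
  let e₂ : ℕ × ℕ → ℕ × ℕ := fun p => (p.2, p.2 + (p.1 + 1))
  let e₃ : ℕ × ℕ → ℕ × ℕ := fun p => (p.2 + (p.1 + 1), p.2)
  have i₁ : Function.Injective e₁ := fun i j hij => congrArg Prod.fst hij
  have i₂ : Function.Injective e₂ := by
    rintro ⟨i, j⟩ ⟨k, l⟩ hij
    simp only [e₂, Prod.mk.injEq] at hij ⊢
    omega
  have i₃ : Function.Injective e₃ := by
    rintro ⟨i, j⟩ ⟨k, l⟩ hij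
    simp only [e₃, Prod.mk.injEq] at hij ⊢
    omega
  have hG' : HasSum (a ∘ e₂) G := by
    have hs := (ha.summable.comp_injective i₂).hasSum
    rwa [(hs.prod_fiberwise hg).unique hG] at hs
  have hH' : HasSum (a ∘ e₃) H := by
    have hs := (ha.summable.comp_injective i₃).hasSum
    rwa [(hs.prod_fiberwise hh).unique hH] at hs
  have key : ∀ {ι : Type} {e : ι → ℕ × ℕ} {T : ℂ}, Function.Injective e → HasSum (a ∘ e) T →
      HasSum ((Set.range e).indicator a) T := by
    intro ι e T he hT
    rw [← he.hasSum_iff fun p hp => Set.indicator_of_notMem hp a]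
    rwa [show (Set.range e).indicator a ∘ e = a ∘ e from
      funext fun i => Set.indicator_of_mem (Set.mem_range_self i) a]
  refine ha.unique ?_
  have hsum := ((key i₁ hD).add (key i₂ hG')).add (key i₃ hH')
  -- The three index sets `i = j`, `i < j` and `j < i` partition `ℕ × ℕ`.
  refine (funext fun p => ?_ : a = _) ▸ hsum
  obtain ⟨i, j⟩ := p
  have m₁ : (i, j) ∈ Set.range e₁ ↔ i = j := by simp [e₁]
  have m₂ : (i, j) ∈ Set.range e₂ ↔ i < j := by
    simp only [e₂, Set.mem_range, Prod.exists, Prod.mk.injEq]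
    exact ⟨fun ⟨l, k, h⟩ => by omega, fun h => ⟨j - i - 1, i, rfl, by omega⟩⟩
  have m₃ : (i, j) ∈ Set.range e₃ ↔ j < i := by
    simp only [e₃, Set.mem_range, Prod.exists, Prod.mk.injEq]
    exact ⟨fun ⟨l, k, h⟩ => by omega, fun h => ⟨i - j - 1, j, by omega, rfl⟩⟩
  classical
  simp only [Set.indicator_apply, m₁, m₂, m₃]
  rcases lt_trichotomy i j with h | h | h
  · simp [h, h.ne, h.not_gt]
  · simp [h]
  · simp [h, h.ne', h.not_gt]

/-- Integrals over consecutive unit intervals glue to the integral over a half-line. -/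
theorem hasSum_integral_unit_intervals {g : ℝ → ℂ} {c : ℝ} (hg : IntegrableOn g (Set.Ioi c))
    (hs : Summable fun i : ℕ => ∫ α in (0 : ℝ)..1, g (i + c + α)) :
    HasSum (fun i : ℕ => ∫ α in (0 : ℝ)..1, g (i + c + α)) (∫ β in Set.Ioi c, g β) := by
  rw [hs.hasSum_iff_tendsto_nat]
  have e : ∀ n : ℕ, ∑ i ∈ Finset.range n, ∫ α in (0 : ℝ)..1, g (i + c + α)
      = ∫ β in c..(n + c), g β := by
    intro n
    have h := intervalIntegral.sum_integral_adjacent_intervals (f := g) (μ := volume)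
      (a := fun i : ℕ => (i + c : ℝ)) (n := n) fun i _ => by
        rw [intervalIntegrable_iff_integrableOn_Ioc_of_le (by simp)]
        refine hg.mono_set fun β hβ => ?_
        have := hβ.1
        have : (0 : ℝ) ≤ i := Nat.cast_nonneg i
        simp only [Set.mem_Ioi]
        linarith
    simp only [Nat.cast_zero, zero_add] at h
    rw [← h]
    refine Finset.sum_congr rfl fun i _ => ?_
    rw [intervalIntegral.integral_comp_add_left]
    congr 1
    · ring
    · push_cast; ring
  simp_rw [e]
  exact intervalIntegral_tendsto_integral_Ioi c hg
    (tendsto_atTop_add_const_right _ _ tendsto_natCast_atTop_atTop)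

theorem hasSum_integral_modZeta_mul {x : ℕ} (hx : 1 ≤ x) {u v : ℂ} (hu : 1 < u.re) (hv : 1 < v.re) :
    HasSum (fun p : ℕ × ℕ => ∫ α in (0 : ℝ)..1,
      ((p.1 + x + α : ℝ) : ℂ) ^ (-u) * ((p.2 + x + α : ℝ) : ℂ) ^ (-v)) (J x u v) := by
  have hx0 : (0 : ℝ) < x := by exact_mod_cast hx
  have hb : ∀ {s : ℂ}, 1 < s.re → ∀ (m : ℕ) {α : ℝ}, 0 < α →
      ‖((m + x + α : ℝ) : ℂ) ^ (-s)‖ ≤ (m + x : ℝ) ^ (-s.re) := by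
    intro s hs m α hα
    rw [norm_ofReal_cpow_neg (by positivity)]
    exact Real.rpow_le_rpow_of_nonpos (by positivity) (by linarith) (by linarith)
  have hc : ∀ (s : ℂ) (m : ℕ),
      ContinuousOn (fun α : ℝ => ((m + x + α : ℝ) : ℂ) ^ (-s)) (Set.Icc 0 1) := by
    refine fun s m => continuousOn_of_forall_continuousAt fun α hα => ?_
    have := hα.1
    exact ContinuousAt.cpow (by fun_prop) continuousAt_const
      (Complex.ofReal_mem_slitPlane.2 (by positivity))
  have h := hasSum_intervalIntegral_mul (ι := ℕ × ℕ) zero_le_one (h := fun _ => 1)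
    intervalIntegrable_const (F := fun p α =>
      ((p.1 + x + α : ℝ) : ℂ) ^ (-u) * ((p.2 + x + α : ℝ) : ℂ) ^ (-v))
    (fun p => (hc u p.1).mul (hc v p.2))
    ((summable_add_rpow_neg hu hx0).mul_of_nonneg (summable_add_rpow_neg hv hx0)
      (fun m => by positivity) fun m => by positivity) (fun p α hα => by
      rw [norm_mul]
      exact mul_le_mul (hb hu _ hα.1) (hb hv _ hα.1) (norm_nonneg _) (by positivity))
  simp only [one_mul] at h
  have e : J x u v = ∫ α in (0 : ℝ)..1, ∑' p : ℕ × ℕ,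
      ((p.1 + x + α : ℝ) : ℂ) ^ (-u) * ((p.2 + x + α : ℝ) : ℂ) ^ (-v) := by
    rw [J]
    refine intervalIntegral.integral_congr_ae (ae_of_all _ fun α hα => ?_)
    rw [Set.uIoc_of_le zero_le_one] at hα
    have hn : ∀ {s : ℂ}, 1 < s.re → Summable fun m : ℕ => ‖((m + x + α : ℝ) : ℂ) ^ (-s)‖ :=
      fun hs => (summable_add_rpow_neg hs hx0).of_nonneg_of_le (fun _ => norm_nonneg _)
        fun m => hb hs m hα.1
    rw [← (hasSum_modZeta x hu hα.1).tsum_eq, ← (hasSum_modZeta x hv hα.1).tsum_eq,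
      tsum_mul_tsum_of_summable_norm (hn hu) (hn hv)]
  rw [e]
  exact h

/-- The right-hand side of the expansion of `J_x(u, v)`. -/
noncomputable def expansion (x : ℕ) (u v : ℂ) : ℂ :=
  (x : ℂ) ^ (1 - u - v) / (u + v - 1)
    + (Complex.Gamma (1 - u) / Complex.Gamma v + Complex.Gamma (1 - v) / Complex.Gamma u)
        * Complex.Gamma (u + v - 1) * riemannZeta (u + v - 1)
    - ∑' n : ℕ, seriesTerm u v x n
    - ∑' n : ℕ, seriesTerm v u x n

theorem J_eq_expansion_of_one_lt_re {x : ℕ} (hx : 1 ≤ x) {u v : ℂ} (hu : ∀ k : ℤ, u ≠ k)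
    (hv : ∀ k : ℤ, v ≠ k) (hu1 : 1 < u.re) (hv1 : 1 < v.re) : J x u v = expansion x u v := by
  have hx0 : (0 : ℝ) < x := by exact_mod_cast hx
  have hJ := hasSum_integral_modZeta_mul hx hu1 hv1
  have huv : 2 < (u + v).re := by simp; linarith
  have hD : HasSum (fun i : ℕ => ∫ α in (0 : ℝ)..1,
      ((i + x + α : ℝ) : ℂ) ^ (-u) * ((i + x + α : ℝ) : ℂ) ^ (-v))
      ((x : ℂ) ^ (1 - u - v) / (u + v - 1)) := by
    have h := hasSum_integral_unit_intervals (c := x)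
      (g := fun β => (β : ℂ) ^ (-u) * (β : ℂ) ^ (-v)) ?_
      (hJ.summable.comp_injective (i := fun i : ℕ => (i, i)) fun i j h => congrArg Prod.fst h)
    · have e : ∫ β in Set.Ioi (x : ℝ), (β : ℂ) ^ (-u) * (β : ℂ) ^ (-v)
          = (x : ℂ) ^ (1 - u - v) / (u + v - 1) := by
        have e1 : ∫ β in Set.Ioi (x : ℝ), (β : ℂ) ^ (-u) * (β : ℂ) ^ (-v)
            = ∫ β in Set.Ioi (x : ℝ), (β : ℂ) ^ (-(u + v)) := by
          refine setIntegral_congr_fun measurableSet_Ioi fun β hβ => ?_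
          have hβ : (β : ℂ) ≠ 0 := by exact_mod_cast (hx0.trans hβ).ne'
          rw [neg_add, Complex.cpow_add _ _ hβ]
        rw [e1, integral_Ioi_cpow_of_lt (by simp at huv ⊢; linarith) hx0, Complex.ofReal_natCast,
          show -(u + v) + 1 = 1 - u - v by ring, show u + v - 1 = -(1 - u - v) by ring, neg_div,
          div_neg]
      rwa [e] at h
    · simpa using integrableOn_Ioi_cpow_mul_cpow (u := u) (v := v) (l := 0) hx0 le_rfl
        (by linarith) (by linarith)
  have hg : ∀ l : ℕ, HasSum (fun i : ℕ => ∫ α in (0 : ℝ)..1,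
      ((i + x + α : ℝ) : ℂ) ^ (-u) * (((i + (l + 1) : ℕ) + x + α : ℝ) : ℂ) ^ (-v))
      (∫ β in Set.Ioi (x : ℝ), (β : ℂ) ^ (-u) * ((β + (l + 1) : ℝ) : ℂ) ^ (-v)) := by
    intro l
    have hs := hJ.summable.comp_injective (i := fun i : ℕ => (i, i + (l + 1)))
      fun i j h => congrArg Prod.fst h
    have e : ∀ (i : ℕ) (α : ℝ), (((i + (l + 1) : ℕ) : ℝ) + x + α) = i + x + α + (l + 1) := by
      intro i α; push_cast; ring
    simp only [Function.comp_def, e] at hs ⊢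
    exact hasSum_integral_unit_intervals (c := x)
      (g := fun β => (β : ℂ) ^ (-u) * ((β + (l + 1) : ℝ) : ℂ) ^ (-v))
      (integrableOn_Ioi_cpow_mul_cpow hx0 (by positivity) (by linarith) (by linarith)) hs
  have hh : ∀ l : ℕ, HasSum (fun i : ℕ => ∫ α in (0 : ℝ)..1,
      (((i + (l + 1) : ℕ) + x + α : ℝ) : ℂ) ^ (-u) * ((i + x + α : ℝ) : ℂ) ^ (-v))
      (∫ β in Set.Ioi (x : ℝ), (β : ℂ) ^ (-v) * ((β + (l + 1) : ℝ) : ℂ) ^ (-u)) := by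
    intro l
    have hs := hJ.summable.comp_injective (i := fun i : ℕ => (i + (l + 1), i))
      fun i j h => congrArg Prod.snd h
    have e : ∀ (i : ℕ) (α : ℝ), (((i + (l + 1) : ℕ) : ℝ) + x + α) = i + x + α + (l + 1) := by
      intro i α; push_cast; ring
    simp only [Function.comp_def, e] at hs ⊢
    simp only [mul_comm (((_ : ℝ) : ℂ) ^ (-u))] at hs ⊢
    exact hasSum_integral_unit_intervals (c := x)
      (g := fun β => (β : ℂ) ^ (-v) * ((β + (l + 1) : ℝ) : ℂ) ^ (-u))
      (integrableOn_Ioi_cpow_mul_cpow hx0 (by positivity) (by linarith)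
        (by rw [add_comm]; linarith)) hs
  have h := hasSum_prod_eq_diag_add hJ hD hg (hasSum_integral_Ioi_cpow_mul hx hu hv hv1 huv) hh
    (hasSum_integral_Ioi_cpow_mul hx hv hu hu1 (by rwa [add_comm]))
  rw [h, expansion, add_comm v u]
  ring

/-! ### Analytic continuation of the expansion -/

theorem isClosed_two_sub_naturals : IsClosed {z : ℂ | ∃ k : ℕ, z = 2 - k} := by
  have h : {z : ℂ | ∃ k : ℕ, z = 2 - k} = {z : ℂ | ∃ k : ℤ, z = k} ∩ {z : ℂ | z.re ≤ 2} := by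
    ext z
    constructor
    · rintro ⟨k, rfl⟩
      exact ⟨⟨2 - k, by push_cast; rfl⟩, by simp⟩
    · rintro ⟨⟨k, rfl⟩, hk⟩
      have hk : k ≤ 2 := by exact_mod_cast (by simpa using hk : (k : ℝ) ≤ 2)
      refine ⟨(2 - k).toNat, ?_⟩
      have : (((2 - k).toNat : ℤ) : ℂ) = ((2 - k : ℤ) : ℂ) := by rw [Int.toNat_of_nonneg (by omega)]
      rw [Int.cast_natCast] at this
      rw [this]
      push_cast
      ring
  rw [h]
  exact isClosed_integers.inter (isClosed_le Complex.continuous_re continuous_const)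

theorem differentiableAt_expansion {x : ℕ} (hx : 1 ≤ x) {u v t₀ : ℂ}
    (hu : ∀ k : ℤ, u + t₀ ≠ k) (hv : ∀ k : ℤ, v + t₀ ≠ k)
    (huv : ∀ k : ℕ, u + t₀ + (v + t₀) ≠ 2 - k) :
    DifferentiableAt ℂ (fun t => expansion x (u + t) (v + t)) t₀ := by
  have hx0 : (x : ℂ) ≠ 0 := by exact_mod_cast (by omega : x ≠ 0)
  have hΓ : ∀ {w : ℂ}, (∀ k : ℤ, w + t₀ ≠ k) →
      DifferentiableAt ℂ (fun t => Complex.Gamma (1 - (w + t))) t₀ := fun hw =>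
    (Complex.differentiableAt_Gamma _ (one_sub_ne_neg_natCast hw)).comp t₀
      (f := fun t => 1 - (_ + t)) (by fun_prop)
  have hΓ' : ∀ {w : ℂ}, (∀ k : ℤ, w + t₀ ≠ k) →
      DifferentiableAt ℂ (fun t => Complex.Gamma (w + t)) t₀ := fun hw =>
    (Complex.differentiableAt_Gamma _ (ne_neg_natCast hw)).comp t₀
      (f := fun t => _ + t) (by fun_prop)
  have h1 : ∀ k : ℕ, u + t₀ + (v + t₀) - 1 ≠ -k := by
    intro k h
    refine huv (k + 1) ?_
    push_cast
    linear_combination h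
  unfold expansion
  refine DifferentiableAt.sub (DifferentiableAt.sub (DifferentiableAt.add ?_
    (DifferentiableAt.mul (DifferentiableAt.mul (DifferentiableAt.add ?_ ?_) ?_) ?_)) ?_) ?_
  · refine DifferentiableAt.div ?_ (by fun_prop) (by simpa using h1 0)
    exact DifferentiableAt.const_cpow (by fun_prop) (Or.inl hx0)
  · exact (hΓ hu).div (hΓ' hv) (Complex.Gamma_ne_zero (ne_neg_natCast hv))
  · exact (hΓ hv).div (hΓ' hu) (Complex.Gamma_ne_zero (ne_neg_natCast hu))
  · exact (Complex.differentiableAt_Gamma _ h1).comp t₀ (f := fun t => u + t + (v + t) - 1)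
      (by fun_prop)
  · refine (differentiableAt_riemannZeta fun h => huv 0 ?_).comp t₀
      (f := fun t => u + t + (v + t) - 1) (by fun_prop)
    simp only [Nat.cast_zero]
    linear_combination h
  · exact differentiableAt_tsum_seriesTerm hx hu hv
  · exact differentiableAt_tsum_seriesTerm hx hv hu

/-- Both sides are holomorphic along the complex line `t ↦ (u + t, v + t)` off a countable closed
set, whose complement is connected, and agree where `Re t` is large. -/
theorem J_eq_expansion {x : ℕ} (hx : 1 ≤ x) {u v : ℂ} (hu : ∀ k : ℤ, u ≠ k) (hv : ∀ k : ℤ, v ≠ k)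
    (huv : ∀ k : ℕ, u + v ≠ 2 - k) : J x u v = expansion x u v := by
  set A : Set ℂ := (fun t => u + t) ⁻¹' {z | ∃ k : ℤ, z = k} with hA
  set B : Set ℂ := (fun t => v + t) ⁻¹' {z | ∃ k : ℤ, z = k} with hB
  set C : Set ℂ := (fun t => u + t + (v + t)) ⁻¹' {z | ∃ k : ℕ, z = 2 - k} with hC
  have hclosed : IsClosed (A ∪ B ∪ C) :=
    ((isClosed_integers.preimage (by fun_prop)).union
      (isClosed_integers.preimage (by fun_prop))).union
      (isClosed_two_sub_naturals.preimage (by fun_prop))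
  have hcount : (A ∪ B ∪ C).Countable := by
    refine ((countable_integers.preimage (add_right_injective u)).union
      (countable_integers.preimage (add_right_injective v))).union ?_
    refine Set.Countable.preimage ?_ fun a b hab => ?_
    · refine (Set.countable_range fun k : ℕ => (2 - k : ℂ)).mono ?_
      rintro z ⟨k, rfl⟩
      exact ⟨k, rfl⟩
    · linear_combination hab / 2
  have hUo := hclosed.isOpen_compl
  have hconn : IsPreconnected (A ∪ B ∪ C)ᶜ :=
    (hcount.isConnected_compl_of_one_lt_rank (by simp)).isPreconnected
  have hmem : ∀ {t}, t ∈ (A ∪ B ∪ C)ᶜ ↔ (∀ k : ℤ, u + t ≠ k) ∧ (∀ k : ℤ, v + t ≠ k) ∧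
      ∀ k : ℕ, u + t + (v + t) ≠ 2 - k := by
    intro t
    simp [hA, hB, hC, and_assoc]
  have hL : DifferentiableOn ℂ (fun t => J x (u + t) (v + t)) (A ∪ B ∪ C)ᶜ := fun t ht =>
    (differentiableAt_J hx (hmem.1 ht).1 (hmem.1 ht).2.1).differentiableWithinAt
  have hR : DifferentiableOn ℂ (fun t => expansion x (u + t) (v + t)) (A ∪ B ∪ C)ᶜ := fun t ht =>
    (differentiableAt_expansion hx (hmem.1 ht).1 (hmem.1 ht).2.1
      (hmem.1 ht).2.2).differentiableWithinAt
  -- A base point far to the right: an integer shift keeps `u` and `v` away from the integers.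
  obtain ⟨K, hK⟩ := exists_nat_gt (1 - u.re)
  obtain ⟨L, hL'⟩ := exists_nat_gt (1 - v.re)
  have hz : ((K + L : ℕ) : ℂ) ∈ (A ∪ B ∪ C)ᶜ := by
    refine hmem.2 ⟨by simpa using add_ne_intCast hu (K + L : ℕ),
      by simpa using add_ne_intCast hv (K + L : ℕ), fun k h => ?_⟩
    refine huv (2 * (K + L) + k) ?_
    push_cast at h ⊢
    linear_combination h
  have heq := (hL.analyticOnNhd hUo).eqOn_of_preconnected_of_eventuallyEq (hR.analyticOnNhd hUo)
    hconn hz ?_ (hmem.2 ⟨by simpa using hu, by simpa using hv, by simpa using huv⟩ : (0 : ℂ) ∈ _)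
  · simpa using heq
  · have hKL : ((K + L : ℕ) : ℂ).re = K + L := by simp
    have hK0 : (0 : ℝ) ≤ K := Nat.cast_nonneg K
    have hL0 : (0 : ℝ) ≤ L := Nat.cast_nonneg L
    have e1 : ∀ᶠ t : ℂ in 𝓝 ((K + L : ℕ) : ℂ), 1 < (u + t).re :=
      continuousAt_const.eventually_lt (by fun_prop) (by rw [Complex.add_re, hKL]; linarith)
    have e2 : ∀ᶠ t : ℂ in 𝓝 ((K + L : ℕ) : ℂ), 1 < (v + t).re :=
      continuousAt_const.eventually_lt (by fun_prop) (by rw [Complex.add_re, hKL]; linarith)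
    filter_upwards [e1, e2, hUo.mem_nhds hz] with t h1 h2 h3
    exact J_eq_expansion_of_one_lt_re hx (hmem.1 h3).1 (hmem.1 h3).2.1 h1 h2

/-! ### Decay of the remainder -/

theorem remIntegrand_eq (N : ℕ) (u v : ℂ) (x : ℕ) :
    remIntegrand N u v x
      = fun β : ℝ => (β : ℂ) ^ (-(2 - u - v)) * ((β + x : ℝ) : ℂ) ^ (-(u + N)) := by
  funext β
  rw [remIntegrand, add_comm (x : ℝ) β, show -(2 - u - v) = u + v - 2 by ring,
    show -(u + (N : ℂ)) = -u - N by ring]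

theorem integrableOn_remIntegrand {N : ℕ} {u v : ℂ} (x : ℕ) (hu : -(N : ℝ) + 1 < u.re)
    (hv : v.re < N + 1) {c : ℝ} (hc : 0 < c) :
    IntegrableOn (remIntegrand N u v x) (Set.Ioi c) := by
  rw [remIntegrand_eq]
  refine integrableOn_Ioi_cpow_mul_cpow hc (Nat.cast_nonneg x) ?_ ?_
  · simp; linarith
  · simp; linarith

/-- Replacing the exponent `N` by a fixed `M ≤ N` gains the factor `(x + 1) ^ (-(N - M))`, since
`x + β ≥ x + 1` on the range of integration. -/
theorem norm_remSummand_le {M N : ℕ} (hMN : M ≤ N) {u v : ℂ} (x : ℕ) (hu : -(M : ℝ) + 1 < u.re)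
    (hv : v.re < M + 1) {l : ℕ} (hl : 1 ≤ l) :
    ‖remSummand N u v x l‖
      ≤ ((x + 1 : ℝ)⁻¹) ^ (N - M) * ((M + 1 - v.re)⁻¹ * (l : ℝ) ^ (-(u.re + M))) := by
  have hl1 : (1 : ℝ) ≤ l := by exact_mod_cast hl
  have hl0 : (0 : ℝ) < l := by linarith
  have hx : (0 : ℝ) ≤ x := Nat.cast_nonneg x
  have hexp : v.re - 2 - M < -1 := by linarith
  have hint : ‖∫ β in Set.Ioi (l : ℝ), remIntegrand N u v x β‖
      ≤ ∫ β in Set.Ioi (l : ℝ), ((x + 1 : ℝ)⁻¹) ^ (N - M) * β ^ (v.re - 2 - M) := by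
    refine norm_integral_le_of_norm_le ((integrableOn_Ioi_rpow_of_lt hexp hl0).const_mul _) ?_
    refine (ae_restrict_iff' measurableSet_Ioi).2 (ae_of_all _ fun β hβ => ?_)
    have hβ1 : 1 < β := hl1.trans_lt hβ
    have hβ0 : 0 < β := by linarith
    rw [remIntegrand_eq]
    dsimp only
    rw [norm_mul, norm_ofReal_cpow_neg hβ0, norm_ofReal_cpow_neg (by linarith)]
    have e1 : -(u + (N : ℂ)).re = -(u.re + M) + -((N - M : ℕ) : ℝ) := by
      rw [Nat.cast_sub hMN]; simp; ring
    have e2 : β ^ (v.re - 2 - M) = β ^ (-(2 - u - v).re) * β ^ (-(u.re + M)) := by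
      rw [← Real.rpow_add hβ0]; congr 1; simp; ring
    rw [e1, Real.rpow_add (by linarith), e2, mul_comm (((x + 1 : ℝ)⁻¹) ^ (N - M)), mul_assoc]
    refine mul_le_mul_of_nonneg_left ?_ (by positivity)
    refine mul_le_mul ?_ ?_ (by positivity) (by positivity)
    · exact Real.rpow_le_rpow_of_nonpos hβ0 (by linarith) (by linarith)
    · rw [Real.rpow_neg (by linarith), Real.rpow_natCast, ← inv_pow]
      exact pow_le_pow_left₀ (by positivity) (inv_anti₀ (by linarith) (by linarith)) _
  rw [integral_const_mul, integral_Ioi_rpow_of_lt hexp hl0] at hint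
  rw [remSummand, norm_mul, Complex.norm_natCast_cpow_of_pos (by omega)]
  refine (mul_le_mul_of_nonneg_left hint (by positivity)).trans_eq ?_
  have e3 : (l : ℝ) ^ (-(u.re + M)) = (l : ℝ) ^ (1 - u - v).re * (l : ℝ) ^ (v.re - 2 - M + 1) := by
    rw [← Real.rpow_add hl0]; congr 1; simp; ring
  rw [e3, show v.re - 2 - (M : ℝ) + 1 = -(M + 1 - v.re) by ring, div_neg, neg_div, neg_neg]
  ring

theorem summable_natCast_add_one_rpow_neg {σ : ℝ} (hσ : 1 < σ) :
    Summable fun l : ℕ => ((l + 1 : ℕ) : ℝ) ^ (-σ) := by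
  simpa using summable_add_rpow_neg hσ one_pos

theorem summable_remSummand {N : ℕ} {u v : ℂ} (x : ℕ) (hu : -(N : ℝ) + 1 < u.re)
    (hv : v.re < N + 1) : Summable fun l : ℕ => remSummand N u v x (l + 1) :=
  Summable.of_norm_bounded
    (((summable_natCast_add_one_rpow_neg (by linarith)).mul_left _).mul_left _)
    fun l => norm_remSummand_le le_rfl x hu hv (Nat.le_add_left 1 l)

/-- The sum in `T_N` decays like `(x + 1) ^ (-N)`: compare every exponent `N` with one fixed
admissible exponent `M`. -/
theorem exists_norm_tsum_remSummand_le (u v : ℂ) (x : ℕ) : ∃ C : ℝ, ∀ᶠ N : ℕ in atTop,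
    ‖∑' l : ℕ, remSummand N u v x (l + 1)‖ ≤ C * ((x + 1 : ℝ)⁻¹) ^ N := by
  obtain ⟨M, hM⟩ := exists_nat_gt (max (1 - u.re) (v.re - 1))
  have hu : -(M : ℝ) + 1 < u.re := by linarith [(le_max_left _ _).trans_lt hM]
  have hv : v.re < M + 1 := by linarith [(le_max_right _ _).trans_lt hM]
  have hs := summable_natCast_add_one_rpow_neg (σ := u.re + M) (by linarith)
  refine ⟨(x + 1 : ℝ) ^ M * ((M + 1 - v.re)⁻¹ * ∑' l : ℕ, ((l + 1 : ℕ) : ℝ) ^ (-(u.re + M))), ?_⟩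
  filter_upwards [eventually_ge_atTop M] with N hN
  have h := tsum_of_norm_bounded ((hs.hasSum.mul_left (M + 1 - v.re)⁻¹).mul_left
    (((x + 1 : ℝ)⁻¹) ^ (N - M))) fun l => norm_remSummand_le hN x hu hv (Nat.le_add_left 1 l)
  refine h.trans_eq ?_
  have e : ((x + 1 : ℝ)⁻¹) ^ (N - M) = (x + 1 : ℝ) ^ M * ((x + 1 : ℝ)⁻¹) ^ N := by
    rw [← Nat.sub_add_cancel hN, Nat.add_sub_cancel, pow_add, inv_pow, inv_pow]
    field_simp
  rw [e]
  ring

/-- The growth of a ratio of rising factorials, from Euler's limit formula for `Γ`. -/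
theorem isBigO_risingRatio {a b : ℂ} (ha : ∀ k : ℕ, a ≠ -k) (hb : ∀ k : ℕ, b ≠ -k) :
    risingRatio a b =O[atTop] fun n : ℕ => (n : ℝ) ^ (a - b).re := by
  have hq : Tendsto (fun n : ℕ => (n : ℂ) / (n + a) * ((n : ℂ) / (n + b))⁻¹ *
      (Complex.GammaSeq b n / Complex.GammaSeq a n)) atTop
      (𝓝 (1 * 1⁻¹ * (Complex.Gamma b / Complex.Gamma a))) :=
    ((tendsto_natCast_div_add_atTop a).mul
      ((tendsto_natCast_div_add_atTop b).inv₀ one_ne_zero)).mul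
      ((Complex.GammaSeq_tendsto_Gamma b).div (Complex.GammaSeq_tendsto_Gamma a)
        (Complex.Gamma_ne_zero ha))
  have hpow : (fun n : ℕ => (n : ℂ) ^ (a - b)) =O[atTop] fun n : ℕ => (n : ℝ) ^ (a - b).re := by
    refine Asymptotics.IsBigO.of_bound 1 ?_
    filter_upwards [eventually_ge_atTop 1] with n hn
    rw [Complex.norm_natCast_cpow_of_pos (by omega), one_mul]
    exact le_abs_self _
  have h := hpow.mul (hq.isBigO_one ℝ)
  simp only [mul_one] at h
  refine h.congr' ?_ EventuallyEq.rfl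
  filter_upwards [eventually_ge_atTop 1] with n hn
  have hn0 : (n : ℂ) ≠ 0 := by exact_mod_cast (by omega : n ≠ 0)
  have hf : (n.factorial : ℂ) ≠ 0 := by exact_mod_cast n.factorial_ne_zero
  have hna : (n : ℂ) + a ≠ 0 := fun h => ha n (by linear_combination h)
  have hnb : (n : ℂ) + b ≠ 0 := fun h => hb n (by linear_combination h)
  have hpa := prod_add_ne_zero ha n
  have hpb := prod_add_ne_zero hb n
  have hca : (n : ℂ) ^ a ≠ 0 := by simp [hn0]
  have hcb : (n : ℂ) ^ b ≠ 0 := by simp [hn0]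
  rw [risingRatio, Finset.prod_div_distrib, Complex.GammaSeq, Complex.GammaSeq,
    Finset.prod_range_succ, Finset.prod_range_succ, Complex.cpow_sub _ _ hn0, add_comm a (n : ℂ),
    add_comm b (n : ℂ)]
  field_simp

theorem isBigO_T {x : ℕ} (hx : 1 ≤ x) {u v : ℂ} (hu : ∀ k : ℤ, u ≠ k) (hv : ∀ k : ℤ, v ≠ k) :
    (fun N : ℕ => T N u v x) =O[atTop]
      fun N : ℕ => (N : ℝ) ^ ((u + v).re - 1) * ((x : ℝ) / (x + 1)) ^ N := by
  have hx0 : (x : ℂ) ≠ 0 := by exact_mod_cast (by omega : x ≠ 0)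
  obtain ⟨C, hC⟩ := exists_norm_tsum_remSummand_le u v x
  have h1 := isBigO_risingRatio (ne_neg_natCast hu) (one_sub_ne_neg_natCast hv)
  have h2 : (fun N : ℕ => ∑' l : ℕ, remSummand N u v x (l + 1)) =O[atTop]
      fun N : ℕ => ((x + 1 : ℝ)⁻¹) ^ N := by
    refine Asymptotics.IsBigO.of_bound C ?_
    filter_upwards [hC] with N hN
    rwa [Real.norm_of_nonneg (by positivity)]
  have h3 : (fun N : ℕ => (x : ℂ) ^ (1 - v) * (x : ℂ) ^ N) =O[atTop] fun N : ℕ => (x : ℝ) ^ N := by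
    refine Asymptotics.IsBigO.of_bound ‖(x : ℂ) ^ (1 - v)‖ (Eventually.of_forall fun N => ?_)
    rw [norm_mul, norm_pow, norm_pow, Complex.norm_natCast, Real.norm_natCast]
  refine ((h1.mul h3).mul h2).congr (fun N => ?_) fun N => ?_
  · rw [T, poch_natCast (ne_neg_natCast hu), poch_natCast (one_sub_ne_neg_natCast hv),
      add_sub_assoc, Complex.cpow_add _ _ hx0, Complex.cpow_natCast, risingRatio,
      Finset.prod_div_distrib]
    ring
  · rw [show (u - (1 - v)).re = (u + v).re - 1 by simp; ring, div_pow, inv_pow]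
    ring

theorem tendsto_rpow_mul_pow_zero (c : ℝ) {r : ℝ} (h0 : 0 ≤ r) (h1 : r < 1) :
    Tendsto (fun N : ℕ => (N : ℝ) ^ c * r ^ N) atTop (𝓝 0) := by
  refine squeeze_zero' (Eventually.of_forall fun N => by positivity) ?_
    (tendsto_pow_const_mul_const_pow_of_lt_one ⌈c⌉₊ h0 h1)
  filter_upwards [eventually_ge_atTop 1] with N hN
  refine mul_le_mul_of_nonneg_right ?_ (by positivity)
  rw [← Real.rpow_natCast]
  exact Real.rpow_le_rpow_of_exponent_le (by exact_mod_cast hN) (Nat.le_ceil c)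

end HurwitzMean

theorem corollary1 (x : ℕ) (hx : 1 ≤ x) (u v : ℂ) (huv : (u, v) ∉ HurwitzMean.E) :
    -- the integral defining `J_x(u, v)` and both series converge
    IntervalIntegrable
        (fun α : ℝ => HurwitzMean.modZeta x u α * HurwitzMean.modZeta x v α) volume 0 1 ∧
    Summable (fun n : ℕ => HurwitzMean.seriesTerm u v x n) ∧
    Summable (fun n : ℕ => HurwitzMean.seriesTerm v u x n) ∧
    -- the exact expansion
    HurwitzMean.J x u v =
      (x : ℂ) ^ (1 - u - v) / (u + v - 1)
        + (Complex.Gamma (1 - u) / Complex.Gamma v + Complex.Gamma (1 - v) / Complex.Gamma u)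
            * Complex.Gamma (u + v - 1) * riemannZeta (u + v - 1)
        - ∑' n : ℕ, HurwitzMean.seriesTerm u v x n
        - ∑' n : ℕ, HurwitzMean.seriesTerm v u x n ∧
    -- the integrals and the sum in `T_N(u, v; x)` converge for all admissible `N`
    (∀ N : ℕ, 1 ≤ N → -(N : ℝ) + 1 < u.re → u.re < N + 1 → -(N : ℝ) + 1 < v.re → v.re < N + 1 →
      (∀ l : ℕ, 1 ≤ l →
        IntegrableOn (HurwitzMean.remIntegrand N u v x) (Set.Ioi (l : ℝ)) volume) ∧
      Summable (fun l : ℕ => HurwitzMean.remSummand N u v x (l + 1))) ∧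
    -- the rate of decay of `T_N(u, v; x)`
    Asymptotics.IsBigO atTop (fun N : ℕ => HurwitzMean.T N u v x)
      (fun N : ℕ => (N : ℝ) ^ ((u + v).re - 1) * ((x : ℝ) / (x + 1)) ^ N) ∧
    Tendsto (fun N : ℕ => HurwitzMean.T N u v x) atTop (𝓝 0) := by
  have hu : ∀ k : ℤ, u ≠ k := fun k h => huv (Or.inr (Or.inl ⟨k, h⟩))
  have hv : ∀ k : ℤ, v ≠ k := fun k h => huv (Or.inr (Or.inr ⟨k, h⟩))
  have hs : ∀ k : ℕ, u + v ≠ 2 - k := fun k h => huv (Or.inl ⟨k, h⟩)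
  have hT := HurwitzMean.isBigO_T hx hu hv
  refine ⟨HurwitzMean.intervalIntegrable_modZeta_mul hx hu hv,
    HurwitzMean.summable_seriesTerm hx hu hv, HurwitzMean.summable_seriesTerm hx hv hu,
    HurwitzMean.J_eq_expansion hx hu hv hs, fun N _ hu1 _ _ hv2 => ⟨fun l hl => ?_,
      HurwitzMean.summable_remSummand x hu1 hv2⟩, hT, hT.trans_tendsto ?_⟩
  · exact HurwitzMean.integrableOn_remIntegrand x hu1 hv2 (by exact_mod_cast hl)
  · exact HurwitzMean.tendsto_rpow_mul_pow_zero _ (by positivity)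
      ((div_lt_one (by positivity)).2 (by linarith))
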